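/- For finite groups $G,H$, let $B(G)$ be the Burnside ring of $G$ (the Grothendieck ring of finite $G$-sets), and $B(H,G)=B(H\times G^{op})$ the Burnside group of finite $(H,G)$-bisets. For $a\in B(G)$ and $K\le G$, let $|a^K|\in\mathbb{Z}$ denote the image of $a$ under the ring homomorphism $B(G)\to\mathbb{Z}$ sending a finite $G$-set $X$ to the number of its $K$-fixed points. Let $\mathbb{F}_2\mathcal{C}$ be the category whose objects are the finite groups, with $\mathrm{Hom}(G,H)=\mathbb{F}_2\otimes_{\mathbb Z} B(H,G)$, and with composition induced by $V\times_HU=(V\times U)/H$. A biset functor over $\mathbb{F}_2$ is an $\mathbb{F}_2$-linear functor from $\mathbb{F}_2\mathcal{C}$ to $\mathbb{F}_2$-vector spaces. An element of a biset functor $F$ is a pair $(R,v)$ with $R$ a finite group and $v\in F(R)$; for a set $\mathcal{G}$ of elements, $\langle\mathcal{G}\rangle$ is the intersection of all subfunctors of $F$ containing $\mathcal{G}$. The functor $F$ is finitely generated if $F=\langle\mathcal{G}\rangle$ for some finite set $\mathcal{G}$, and finitely presented if there is an exact sequence $Q\to P\to F\to 0$ of biset functors with $P$ and $Q$ finitely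 generated and projective. Let $\mathbb{F}_2B$ be the linearized Burnside functor $G\mapsto\mathbb{F}_2\otimes B(G)$ (with $[U][X]=[U\times_GX]$). Let $B^\times$ be the biset functor over $\mathbb{F}_2$ whose value at $G$ is the group of units of $B(G)$ (an elementary abelian $2$-group), where an $(H,G)$-biset $U$ acts by tensor induction, i.e. by the multiplicative map $T_U:B(G)\to B(H)$ which extends $X\mapsto\mathrm{Hom}_G(U^{op},X)$ and satisfies $|T_U(a)^K|=\prod_{u\in K\backslash U/G}|a^{K^u}|$ for all $K\le H$, with $K^u=\{g\in G\mid ug\in Ku\}$. Let $\widehat{B^\times}=\mathrm{Hom}_{\mathbb{F}_2}(B^\times,\mathbb{F}_2)$ be its dual functor, on which $\alpha\in\mathbb{F}_2B(H,G)$ acts by the transpose of $B^\times(\alpha^{op})$. Let $\jmath:\mathbb{F}_2B\to\widehat{B^\times}$ be the morphism of biset functors sending $G/K$ to the linear form $u\mapsto|u^K|_+$, where $(+1)_+=0$ and $(-1)_+=1$, and let $L=\mathrm{Ker}\,\jmath$. Then: 1. $\widehat{B^\times}(\mathbf{1})\cong\mathbb{F}_2$, and if $u$ is its non-zero element, then $\langle\{(\mathbf{1},u)\}\rangle=\widehat{B^\times}$.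 2. The functor $L$ is not finitely generated. 3. The functor $\widehat{B^\times}$ is not finitely presented. -/

import Mathlib

open CategoryTheory MulOpposite
open scoped TensorProduct

noncomputable section

namespace BurnsideUnits


/-! ### The Grothendieck group and ring -/

section Grothendieck

/-- The Grothendieck group of a commutative additive monoid. -/
def Gro (M : Type) [AddCommMonoid M] : Type := Algebra.GrothendieckAddGroup M

variable {M N : Type} [AddCommMonoid M] [AddCommMonoid N] {C : Type} [AddCommGroup C]

instance : AddCommGroup (Gro M) :=
  inferInstanceAs (AddCommGroup (Algebra.GrothendieckAddGroup M))

namespace Gro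

def of : M →+ Gro M := Algebra.GrothendieckAddGroup.of (M := M)

theorem ind {P : Gro M → Prop} (h : ∀ x y : M, P (of x - of y)) (a : Gro M) : P a := by
  obtain ⟨⟨x, y⟩, hxy⟩ := (AddLocalization.addMonoidOf (⊤ : AddSubmonoid M)).surj a
  have : a = of x - of (y : M) := eq_sub_of_add_eq hxy
  rw [this]
  exact h _ _

@[ext]
theorem hom_ext {f g : Gro M →+ C} (h : ∀ x, f (of x) = g (of x)) : f = g := by
  ext a
  induction a using ind with
  | h x y => rw [map_sub, map_sub, h, h]

/-- The universal property of the Grothendieck group. -/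
def lift (f : M →+ C) : Gro M →+ C := Algebra.GrothendieckAddGroup.lift f

@[simp]
theorem lift_of (f : M →+ C) (x : M) : lift f (of x) = f x :=
  DFunLike.congr_fun (Algebra.GrothendieckAddGroup.lift.symm_apply_apply f) x

/-- The biadditive version of the universal property. -/
def lift₂ (f : M →+ N →+ C) : Gro M →+ Gro N →+ C :=
  lift { toFun := fun x => lift (f x)
         map_zero' := by ext; simp
         map_add' := fun x y => by ext; simp }

@[simp]
theorem lift₂_of (f : M →+ N →+ C) (x : M) (y : N) : lift₂ f (of x) (of y) = f x y := by
  simp [lift₂]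

section Ring

variable {S : Type} [CommSemiring S]

def mulHom : Gro S →+ Gro S →+ Gro S :=
  lift₂ (((AddMonoidHom.compHom (of : S →+ Gro S))).comp AddMonoidHom.mul)

theorem mulHom_of (x y : S) : mulHom (of x) (of y) = of (x * y) := by
  simp [mulHom]

/-- The Grothendieck group of a commutative semiring is a commutative ring. -/
instance : CommRing (Gro S) :=
  { (inferInstance : AddCommGroup (Gro S)) with
    mul := fun a b => mulHom a b
    one := of 1
    left_distrib := fun a b c => map_add (mulHom a) b c
    right_distrib := fun a b c => by
      change mulHom (a + b) c = mulHom a c + mulHom b c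
      rw [map_add]; rfl
    zero_mul := fun a => by
      change mulHom 0 a = 0
      rw [map_zero]; rfl
    mul_zero := fun a => map_zero (mulHom a)
    mul_assoc := fun a b c => by
      change mulHom (mulHom a b) c = mulHom a (mulHom b c)
      induction a using ind with
      | h a a' =>
      induction b using ind with
      | h b b' =>
      induction c using ind with
      | h c c' =>
      simp only [map_sub, AddMonoidHom.sub_apply, mulHom_of, mul_assoc]
    one_mul := fun a => by
      change mulHom (of 1) a = a
      induction a using ind with
      | h a a' => simp only [map_sub, mulHom_of, one_mul]
    mul_one := fun a => by
      change mulHom a (of 1) = a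
      induction a using ind with
      | h a a' => simp only [map_sub, AddMonoidHom.sub_apply, mulHom_of, mul_one]
    mul_comm := fun a b => by
      change mulHom a b = mulHom b a
      induction a using ind with
      | h a a' =>
      induction b using ind with
      | h b b' =>
      simp only [map_sub, AddMonoidHom.sub_apply, mulHom_of, mul_comm]
      abel }

theorem of_mul (x y : S) : (of (x * y) : Gro S) = of x * of y := (mulHom_of x y).symm

theorem of_one : (of 1 : Gro S) = 1 := rfl

/-- The universal property of the Grothendieck ring. -/
def liftRing {R : Type} [CommRing R] (f : S →+* R) : Gro S →+* R :=
  { lift (f : S →+ R) with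
    map_one' := by
      change lift (f : S →+ R) (of 1) = 1
      simp
    map_mul' := fun a b => by
      change lift (f : S →+ R) (a * b) = lift (f : S →+ R) a * lift (f : S →+ R) b
      induction a using ind with
      | h a a' =>
      induction b using ind with
      | h b b' =>
      simp only [sub_mul, mul_sub, map_sub, ← of_mul, lift_of]
      simp }

@[simp]
theorem liftRing_of {R : Type} [CommRing R] (f : S →+* R) (x : S) : liftRing f (of x) = f x :=
  lift_of (f : S →+ R) x

end Ring

end Gro

end Grothendieck

/-! ### Isomorphism classes of finite `G`-sets -/

section GSets

/-- Two `G`-sets are isomorphic. -/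
def GIso (G : Type) [Group G] (X Y : Type) [MulAction G X] [MulAction G Y] : Prop :=
  ∃ e : X ≃ Y, ∀ (g : G) (x : X), e (g • x) = g • e x

variable {G : Type} [Group G]

theorem GIso.refl (X : Type) [MulAction G X] : GIso G X X := ⟨Equiv.refl X, fun _ _ => rfl⟩

theorem GIso.symm {X Y : Type} [MulAction G X] [MulAction G Y] (h : GIso G X Y) :
    GIso G Y X := by
  obtain ⟨e, he⟩ := h
  exact ⟨e.symm, fun g y => by rw [Equiv.symm_apply_eq, he, Equiv.apply_symm_apply]⟩

theorem GIso.trans {X Y Z : Type} [MulAction G X] [MulAction G Y] [MulAction G Z]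
    (h : GIso G X Y) (h' : GIso G Y Z) : GIso G X Z := by
  obtain ⟨e, he⟩ := h
  obtain ⟨f, hf⟩ := h'
  exact ⟨e.trans f, fun g y => by simp [he, hf]⟩

/-- A `G`-set with underlying set `{0, …, n - 1}`; every finite `G`-set is isomorphic to one. -/
structure FinGSet (G : Type) [Group G] where
  n : ℕ
  act : MulAction G (Fin n)

variable (G) in
/-- Isomorphism of `G`-sets as an equivalence relation. -/
def gsetSetoid : Setoid (FinGSet G) where
  r a b := @GIso G _ (Fin a.n) (Fin b.n) a.act b.act
  iseqv :=
    { refl := fun a => letI := a.act; GIso.refl _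
      symm := fun {a b} h => letI := a.act; letI := b.act; GIso.symm h
      trans := fun {a b c} h h' =>
        letI := a.act; letI := b.act; letI := c.act; GIso.trans h h' }

variable (G) in
/-- The set of isomorphism classes of finite `G`-sets. -/
def GSetClass : Type := Quotient (gsetSetoid G)

namespace GSetClass

/-- The action of `G` on `{0, …, n - 1}` transported from a `G`-set of cardinality `n`. -/
def model (G : Type) [Group G] (X : Type) [Finite X] [MulAction G X] : FinGSet G where
  n := Nat.card X
  act :=
    { smul := fun g i => Finite.equivFin X (g • (Finite.equivFin X).symm i)
      one_smul := fun i => by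
        change Finite.equivFin X ((1 : G) • (Finite.equivFin X).symm i) = i
        simp
      mul_smul := fun g h i => by
        change Finite.equivFin X ((g * h) • (Finite.equivFin X).symm i) =
          Finite.equivFin X (g • (Finite.equivFin X).symm
            (Finite.equivFin X (h • (Finite.equivFin X).symm i)))
        simp [mul_smul] }

theorem model_iso (X : Type) [Finite X] [MulAction G X] :
    letI := (model G X).act
    GIso G X (Fin (model G X).n) := by
  let _ := (model G X).act
  refine ⟨Finite.equivFin X, fun g x => ?_⟩
  change _ = Finite.equivFin X (g • (Finite.equivFin X).symm (Finite.equivFin X x))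
  rw [Equiv.symm_apply_apply]
  rfl

/-- The isomorphism class of a finite `G`-set. -/
def mk (G : Type) [Group G] (X : Type) [Finite X] [MulAction G X] : GSetClass G :=
  Quotient.mk (gsetSetoid G) (model G X)

theorem mk_eq_mk_iff {X Y : Type} [Finite X] [Finite Y] [MulAction G X] [MulAction G Y] :
    mk G X = mk G Y ↔ GIso G X Y := by
  let _ := (model G X).act
  let _ := (model G Y).act
  constructor
  · intro h
    have h' : GIso G (Fin (model G X).n) (Fin (model G Y).n) := Quotient.exact h
    exact (model_iso X).trans (h'.trans (model_iso Y).symm)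
  · intro h
    exact Quotient.sound (s := gsetSetoid G)
      ((model_iso X).symm.trans (h.trans (model_iso Y)))

theorem mk_eq_mk {X Y : Type} [Finite X] [Finite Y] [MulAction G X] [MulAction G Y]
    (e : X ≃ Y) (he : ∀ (g : G) (x : X), e (g • x) = g • e x) : mk G X = mk G Y :=
  mk_eq_mk_iff.2 ⟨e, he⟩

theorem ind {P : GSetClass G → Prop}
    (h : ∀ (X : Type) [Finite X] [MulAction G X], P (mk G X)) (a : GSetClass G) : P a := by
  refine Quotient.inductionOn (s := gsetSetoid G) a fun s => ?_
  let _ := s.act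
  have : Quotient.mk (gsetSetoid G) s = mk G (Fin s.n) :=
    Quotient.sound (s := gsetSetoid G) (model_iso (Fin s.n))
  rw [this]
  exact h _

/-- Functions on isomorphism classes from isomorphism invariants of finite `G`-sets. -/
def lift {α : Type} (f : ∀ (X : Type) [Finite X] [MulAction G X], α)
    (hf : ∀ (X Y : Type) [Finite X] [Finite Y] [MulAction G X] [MulAction G Y],
      GIso G X Y → f X = f Y) (a : GSetClass G) : α :=
  Quotient.lift (s := gsetSetoid G) (fun s => letI := s.act; f (Fin s.n))
    (fun a b h => letI := a.act; letI := b.act; hf (Fin a.n) (Fin b.n) h) a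

theorem lift_mk {α : Type} (f : ∀ (X : Type) [Finite X] [MulAction G X], α)
    (hf : ∀ (X Y : Type) [Finite X] [Finite Y] [MulAction G X] [MulAction G Y],
      GIso G X Y → f X = f Y) (X : Type) [Finite X] [MulAction G X] :
    lift f hf (mk G X) = f X := by
  let _ := (model G X).act
  exact hf _ _ (model_iso X).symm

end GSetClass

/-- The empty `G`-set. -/
instance emptyAction : MulAction G Empty where
  smul _ x := x
  one_smul x := x.elim
  mul_smul _ _ x := x.elim

namespace GSetClass

instance : Zero (GSetClass G) := ⟨mk G Empty⟩

instance : One (GSetClass G) := ⟨mk G Unit⟩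

/-- Disjoint union. -/
instance : Add (GSetClass G) :=
  ⟨fun a b => lift (fun X _ _ => lift (fun Y _ _ => mk G (X ⊕ Y))
    (fun Y Y' _ _ _ _ ⟨e, he⟩ => mk_eq_mk (Equiv.sumCongr (Equiv.refl X) e) (by
      rintro g (x | y) <;> simp [he]) ) b)
    (fun X X' _ _ _ _ ⟨e, he⟩ => by
      induction b using ind with
      | h Y =>
      rw [lift_mk, lift_mk]
      exact mk_eq_mk (Equiv.sumCongr e (Equiv.refl Y)) (by rintro g (x | y) <;> simp [he])) a⟩

/-- Cartesian product. -/
instance : Mul (GSetClass G) :=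
  ⟨fun a b => lift (fun X _ _ => lift (fun Y _ _ => mk G (X × Y))
    (fun Y Y' _ _ _ _ ⟨e, he⟩ => mk_eq_mk (Equiv.prodCongr (Equiv.refl X) e) (by
      rintro g ⟨x, y⟩; simp [he]) ) b)
    (fun X X' _ _ _ _ ⟨e, he⟩ => by
      induction b using ind with
      | h Y =>
      rw [lift_mk, lift_mk]
      exact mk_eq_mk (Equiv.prodCongr e (Equiv.refl Y)) (by rintro g ⟨x, y⟩; simp [he])) a⟩

section

variable (X Y : Type) [Finite X] [Finite Y] [MulAction G X] [MulAction G Y]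

theorem mk_add : mk G X + mk G Y = mk G (X ⊕ Y) := by
  change lift _ _ _ = _
  rw [lift_mk, lift_mk]

theorem mk_mul : mk G X * mk G Y = mk G (X × Y) := by
  change lift _ _ _ = _
  rw [lift_mk, lift_mk]

theorem zero_def : (0 : GSetClass G) = mk G Empty := rfl

theorem one_def : (1 : GSetClass G) = mk G Unit := rfl

end

/-- Isomorphism classes of finite `G`-sets form a commutative semiring. -/
instance : CommSemiring (GSetClass G) where
  add_assoc a b c := by
    induction a using ind with | h X =>
    induction b using ind with | h Y =>
    induction c using ind with | h Z =>
    simp only [mk_add]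
    exact mk_eq_mk (Equiv.sumAssoc X Y Z) (by rintro g ((x | y) | z) <;> rfl)
  zero_add a := by
    induction a using ind with | h X =>
    simp only [mk_add, zero_def]
    exact mk_eq_mk (Equiv.emptySum Empty X) (by rintro g (x | y); exacts [x.elim, rfl])
  add_zero a := by
    induction a using ind with | h X =>
    simp only [mk_add, zero_def]
    exact mk_eq_mk (Equiv.sumEmpty X Empty) (by rintro g (x | y); exacts [rfl, y.elim])
  add_comm a b := by
    induction a using ind with | h X =>
    induction b using ind with | h Y =>
    simp only [mk_add]
    exact mk_eq_mk (Equiv.sumComm X Y) (by rintro g (x | y) <;> rfl)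
  nsmul := nsmulRec
  left_distrib a b c := by
    induction a using ind with | h X =>
    induction b using ind with | h Y =>
    induction c using ind with | h Z =>
    simp only [mk_add, mk_mul]
    exact mk_eq_mk (Equiv.prodSumDistrib X Y Z) (by rintro g ⟨x, (y | z)⟩ <;> rfl)
  right_distrib a b c := by
    induction a using ind with | h X =>
    induction b using ind with | h Y =>
    induction c using ind with | h Z =>
    simp only [mk_add, mk_mul]
    exact mk_eq_mk (Equiv.sumProdDistrib X Y Z) (by rintro g ⟨(x | y), z⟩ <;> rfl)
  zero_mul a := by
    induction a using ind with | h X =>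
    simp only [mk_mul, zero_def]
    exact mk_eq_mk (Equiv.equivOfIsEmpty _ _) (by rintro g ⟨x, y⟩; exact x.elim)
  mul_zero a := by
    induction a using ind with | h X =>
    simp only [mk_mul, zero_def]
    exact mk_eq_mk (Equiv.equivOfIsEmpty _ _) (by rintro g ⟨x, y⟩; exact y.elim)
  mul_assoc a b c := by
    induction a using ind with | h X =>
    induction b using ind with | h Y =>
    induction c using ind with | h Z =>
    simp only [mk_mul]
    exact mk_eq_mk (Equiv.prodAssoc X Y Z) (by rintro g ⟨⟨x, y⟩, z⟩; rfl)
  one_mul a := by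
    induction a using ind with | h X =>
    simp only [mk_mul, one_def]
    exact mk_eq_mk (Equiv.punitProd X) (by rintro g ⟨x, y⟩; rfl)
  mul_one a := by
    induction a using ind with | h X =>
    simp only [mk_mul, one_def]
    exact mk_eq_mk (Equiv.prodPUnit X) (by rintro g ⟨x, y⟩; rfl)
  mul_comm a b := by
    induction a using ind with | h X =>
    induction b using ind with | h Y =>
    simp only [mk_mul]
    exact mk_eq_mk (Equiv.prodComm X Y) (by rintro g ⟨x, y⟩; rfl)

end GSetClass

/-- The Burnside ring `B(G)`: the Grothendieck ring of finite `G`-sets, with respect to disjoint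
union and cartesian product. -/
abbrev Burnside (G : Type) [Group G] : Type := Gro (GSetClass G)

/-- The class of a finite `G`-set in the Burnside ring. -/
def cls (G : Type) [Group G] (X : Type) [Finite X] [MulAction G X] : Burnside G :=
  Gro.of (GSetClass.mk G X)

end GSets


/-! ### Bisets -/

section Bisets

/-- Isomorphism classes of finite `(H, G)`-bisets, i.e. of finite `H × Gᵒᵖ`-sets. The Burnside
group `B(H, G)` is the Grothendieck group of this monoid. -/
abbrev BisetClass (H G : Type) [Group H] [Group G] : Type := GSetClass (H × Gᵐᵒᵖ)

variable (K H G : Type) [Group K] [Group H] [Group G]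

theorem left_right_comm {H N X : Type} [Group H] [Group N] [MulAction (H × N) X] (h : H) (n : N)
    (x : X) : ((h, 1) : H × N) • ((1, n) : H × N) • x = ((1, n) : H × N) • ((h, 1) : H × N) • x := by
  simp [smul_smul]

theorem left_right {H N X : Type} [Group H] [Group N] [MulAction (H × N) X] (h : H) (n : N)
    (x : X) : ((h, n) : H × N) • x = ((h, 1) : H × N) • ((1, n) : H × N) • x := by
  simp [smul_smul]

/-- The set `G` as a `(G, G)`-biset, by left and right multiplication. -/
@[ext]
structure IdBiset : Type where
  val : G

/-- The underlying bijection. -/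
def IdBiset.equiv : IdBiset G ≃ G := ⟨IdBiset.val, IdBiset.mk, fun _ => rfl, fun _ => rfl⟩

instance [Finite G] : Finite (IdBiset G) := Finite.of_equiv G (IdBiset.equiv G).symm

instance : MulAction (G × Gᵐᵒᵖ) (IdBiset G) where
  smul p x := ⟨p.1 * x.val * p.2.unop⟩
  one_smul x := by
    ext
    change 1 * x.val * 1 = x.val
    simp
  mul_smul p q x := by
    ext
    change p.1 * q.1 * x.val * (q.2.unop * p.2.unop) =
      p.1 * (q.1 * x.val * q.2.unop) * p.2.unop
    simp [mul_assoc]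

theorem idBiset_smul (p : G × Gᵐᵒᵖ) (x : IdBiset G) :
    p • x = ⟨p.1 * x.val * p.2.unop⟩ := rfl

section Op

variable (U : Type) [MulAction (H × Gᵐᵒᵖ) U]

/-- The opposite of an `(H, G)`-biset `U`: the `(G, H)`-biset `U` with `g · u · h = h⁻¹ u g⁻¹`. -/
@[ext]
structure OpBiset (_H _G U : Type) : Type where
  val : U

/-- The underlying bijection. -/
def OpBiset.equiv : OpBiset H G U ≃ U := ⟨OpBiset.val, OpBiset.mk, fun _ => rfl, fun _ => rfl⟩

instance [Finite U] : Finite (OpBiset H G U) := Finite.of_equiv U (OpBiset.equiv H G U).symm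

instance : MulAction (G × Hᵐᵒᵖ) (OpBiset H G U) where
  smul p u := ⟨((p.2.unop⁻¹, op p.1⁻¹) : H × Gᵐᵒᵖ) • u.val⟩
  one_smul u := by
    ext
    change (((1 : H)⁻¹, op (1 : G)⁻¹) : H × Gᵐᵒᵖ) • u.val = u.val
    simp [← Prod.one_eq_mk]
  mul_smul p q u := by
    ext
    change (((q.2.unop * p.2.unop)⁻¹, op (p.1 * q.1)⁻¹) : H × Gᵐᵒᵖ) • u.val =
      ((p.2.unop⁻¹, op p.1⁻¹) : H × Gᵐᵒᵖ) • ((q.2.unop⁻¹, op q.1⁻¹) : H × Gᵐᵒᵖ) • u.val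
    simp [smul_smul]

variable {H G U} in
theorem opBiset_smul (p : G × Hᵐᵒᵖ) (u : OpBiset H G U) :
    p • u = ⟨((p.2.unop⁻¹, op p.1⁻¹) : H × Gᵐᵒᵖ) • u.val⟩ := rfl

end Op

section Comp

variable (V U : Type) [MulAction (K × Hᵐᵒᵖ) V] [MulAction (H × Gᵐᵒᵖ) U]

/-- The orbit relation of `H` acting on the right on `V × U` by `(v, u) h = (v h, h⁻¹ u)`. -/
def compSetoid : Setoid (V × U) where
  r p q := ∃ h : H, q = (((1, op h) : K × Hᵐᵒᵖ) • p.1, ((h⁻¹, 1) : H × Gᵐᵒᵖ) • p.2)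
  iseqv :=
    { refl := fun p => ⟨1, by
        have h1 : ((1, op 1) : K × Hᵐᵒᵖ) = 1 := rfl
        have h2 : (((1 : H)⁻¹, 1) : H × Gᵐᵒᵖ) = 1 := by simp
        rw [h1, h2, one_smul, one_smul]⟩
      symm := by
        rintro p q ⟨h, rfl⟩
        refine ⟨h⁻¹, ?_⟩
        simp [smul_smul, ← Prod.one_eq_mk]
      trans := by
        rintro p q r ⟨h, rfl⟩ ⟨h', rfl⟩
        refine ⟨h * h', ?_⟩
        simp [smul_smul] }

/-- The composition `V ×_H U = (V × U) / H` of a `(K, H)`-biset `V` and an `(H, G)`-biset `U`. -/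
def Comp : Type := Quotient (compSetoid K H G V U)

instance [Finite V] [Finite U] : Finite (Comp K H G V U) :=
  inferInstanceAs (Finite (Quotient (compSetoid K H G V U)))

variable {V U}

def Comp.mk (v : V) (u : U) : Comp K H G V U := Quotient.mk (compSetoid K H G V U) (v, u)

variable {K H G}

theorem Comp.ind {P : Comp K H G V U → Prop} (h : ∀ v u, P (Comp.mk K H G v u))
    (x : Comp K H G V U) : P x :=
  Quotient.inductionOn (s := compSetoid K H G V U) x fun p => h p.1 p.2

theorem Comp.mk_right_left (h : H) (v : V) (u : U) :
    Comp.mk K H G (((1, op h) : K × Hᵐᵒᵖ) • v) u = Comp.mk K H G v (((h, 1) : H × Gᵐᵒᵖ) • u) := by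
  refine (Quotient.sound (s := compSetoid K H G V U) ⟨h, ?_⟩).symm
  simp [smul_smul, ← Prod.one_eq_mk]

def Comp.lift {α : Type} (f : V → U → α)
    (hf : ∀ (h : H) v u, f (((1, op h) : K × Hᵐᵒᵖ) • v) u = f v (((h, 1) : H × Gᵐᵒᵖ) • u))
    (x : Comp K H G V U) : α :=
  Quotient.lift (s := compSetoid K H G V U) (fun p => f p.1 p.2) (by
    rintro p q ⟨h, rfl⟩
    simp only [hf, smul_smul]
    simp [← Prod.one_eq_mk]) x

@[simp]
theorem Comp.lift_mk {α : Type} (f : V → U → α)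
    (hf : ∀ (h : H) v u, f (((1, op h) : K × Hᵐᵒᵖ) • v) u = f v (((h, 1) : H × Gᵐᵒᵖ) • u))
    (v : V) (u : U) : Comp.lift f hf (Comp.mk K H G v u) = f v u := rfl

instance : MulAction (K × Gᵐᵒᵖ) (Comp K H G V U) where
  smul p := Comp.lift
    (fun v u => Comp.mk K H G (((p.1, 1) : K × Hᵐᵒᵖ) • v) (((1, p.2) : H × Gᵐᵒᵖ) • u)) (by
      intro h v u
      rw [left_right_comm, Comp.mk_right_left, left_right_comm])
  one_smul x := by
    induction x using Comp.ind with | h v u =>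
    change Comp.mk K H G (((1, 1) : K × Hᵐᵒᵖ) • v) (((1, 1) : H × Gᵐᵒᵖ) • u) = _
    simp [← Prod.one_eq_mk]
  mul_smul p q x := by
    induction x using Comp.ind with | h v u =>
    change Comp.mk K H G (((p.1 * q.1, 1) : K × Hᵐᵒᵖ) • v) (((1, p.2 * q.2) : H × Gᵐᵒᵖ) • u) =
      Comp.mk K H G (((p.1, 1) : K × Hᵐᵒᵖ) • ((q.1, 1) : K × Hᵐᵒᵖ) • v)
        (((1, p.2) : H × Gᵐᵒᵖ) • ((1, q.2) : H × Gᵐᵒᵖ) • u)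
    simp [smul_smul]

theorem Comp.smul_mk (k : K) (g : Gᵐᵒᵖ) (v : V) (u : U) :
    ((k, g) : K × Gᵐᵒᵖ) • Comp.mk K H G v u =
      Comp.mk K H G (((k, 1) : K × Hᵐᵒᵖ) • v) (((1, g) : H × Gᵐᵒᵖ) • u) := rfl

end Comp

section Tens

variable (U X : Type) [MulAction (H × Gᵐᵒᵖ) U] [MulAction G X]

/-- The orbit relation of `G` acting on the right on `U × X` by `(u, x) g = (u g, g⁻¹ x)`. -/
def tensSetoid : Setoid (U × X) where
  r p q := ∃ g : G, q = (((1, op g) : H × Gᵐᵒᵖ) • p.1, g⁻¹ • p.2)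
  iseqv :=
    { refl := fun p => ⟨1, by
        have h1 : ((1, op 1) : H × Gᵐᵒᵖ) = 1 := rfl
        rw [h1, inv_one, one_smul, one_smul]⟩
      symm := by
        rintro p q ⟨h, rfl⟩
        refine ⟨h⁻¹, ?_⟩
        simp [smul_smul, ← Prod.one_eq_mk]
      trans := by
        rintro p q r ⟨h, rfl⟩ ⟨h', rfl⟩
        refine ⟨h * h', ?_⟩
        simp [smul_smul] }

/-- The `H`-set `U ×_G X = (U × X) / G`, for an `(H, G)`-biset `U` and a `G`-set `X`. -/
def Tens : Type := Quotient (tensSetoid H G U X)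

instance [Finite U] [Finite X] : Finite (Tens H G U X) :=
  inferInstanceAs (Finite (Quotient (tensSetoid H G U X)))

variable {U X}

def Tens.mk (u : U) (x : X) : Tens H G U X := Quotient.mk (tensSetoid H G U X) (u, x)

variable {H G}

theorem Tens.ind {P : Tens H G U X → Prop} (h : ∀ u x, P (Tens.mk H G u x))
    (x : Tens H G U X) : P x :=
  Quotient.inductionOn (s := tensSetoid H G U X) x fun p => h p.1 p.2

theorem Tens.mk_right_left (g : G) (u : U) (x : X) :
    Tens.mk H G (((1, op g) : H × Gᵐᵒᵖ) • u) x = Tens.mk H G u (g • x) := by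
  refine (Quotient.sound (s := tensSetoid H G U X) ⟨g, ?_⟩).symm
  simp [smul_smul]

def Tens.lift {α : Type} (f : U → X → α)
    (hf : ∀ (g : G) u x, f (((1, op g) : H × Gᵐᵒᵖ) • u) x = f u (g • x))
    (x : Tens H G U X) : α :=
  Quotient.lift (s := tensSetoid H G U X) (fun p => f p.1 p.2) (by
    rintro p q ⟨h, rfl⟩
    simp only [hf, smul_smul]
    simp) x

@[simp]
theorem Tens.lift_mk {α : Type} (f : U → X → α)
    (hf : ∀ (g : G) u x, f (((1, op g) : H × Gᵐᵒᵖ) • u) x = f u (g • x))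
    (u : U) (x : X) : Tens.lift f hf (Tens.mk H G u x) = f u x := rfl

instance : MulAction H (Tens H G U X) where
  smul h := Tens.lift (fun u x => Tens.mk H G (((h, 1) : H × Gᵐᵒᵖ) • u) x) (by
      intro g u x
      rw [left_right_comm, Tens.mk_right_left])
  one_smul x := by
    induction x using Tens.ind with | h v u =>
    change Tens.mk H G (((1, 1) : H × Gᵐᵒᵖ) • v) u = _
    simp [← Prod.one_eq_mk]
  mul_smul p q x := by
    induction x using Tens.ind with | h v u =>
    change Tens.mk H G (((p * q, 1) : H × Gᵐᵒᵖ) • v) u =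
      Tens.mk H G (((p, 1) : H × Gᵐᵒᵖ) • ((q, 1) : H × Gᵐᵒᵖ) • v) u
    simp [smul_smul]

theorem Tens.smul_mk (h : H) (u : U) (x : X) :
    h • Tens.mk H G u x = Tens.mk H G (((h, 1) : H × Gᵐᵒᵖ) • u) x := rfl

end Tens

end Bisets

/-! ### Operations on isomorphism classes -/

section Classes

variable {K H G F : Type} [Group K] [Group H] [Group G] [Group F]

open GSetClass

/-- The opposite of (the class of) a biset, as an additive map. -/
def opClass : BisetClass H G →+ BisetClass G H where
  toFun := lift (fun U _ _ => GSetClass.mk (G × Hᵐᵒᵖ) (OpBiset H G U))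
    (fun U U' _ _ _ _ ⟨e, he⟩ => mk_eq_mk
      ((OpBiset.equiv H G U).trans (e.trans (OpBiset.equiv H G U').symm))
      (fun g u => OpBiset.ext (he _ u.val)))
  map_zero' := by
    rw [zero_def, lift_mk]
    exact mk_eq_mk (OpBiset.equiv H G Empty) (fun g u => u.val.elim)
  map_add' a b := by
    induction a using GSetClass.ind with | h U =>
    induction b using GSetClass.ind with | h V =>
    simp only [mk_add, lift_mk]
    refine mk_eq_mk ((OpBiset.equiv H G (U ⊕ V)).trans
      (Equiv.sumCongr (OpBiset.equiv H G U).symm (OpBiset.equiv H G V).symm)) ?_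
    rintro g ⟨u | v⟩ <;> rfl

theorem opClass_mk (U : Type) [Finite U] [MulAction (H × Gᵐᵒᵖ) U] :
    opClass (GSetClass.mk (H × Gᵐᵒᵖ) U) = GSetClass.mk (G × Hᵐᵒᵖ) (OpBiset H G U) := by
  simp only [opClass, AddMonoidHom.coe_mk, ZeroHom.coe_mk, lift_mk]

variable (G) in
/-- The class of the identity biset. -/
def idClass [Finite G] : BisetClass G G := GSetClass.mk (G × Gᵐᵒᵖ) (IdBiset G)

theorem comp_congr {V V' U U' : Type} [MulAction (K × Hᵐᵒᵖ) V] [MulAction (K × Hᵐᵒᵖ) V']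
    [MulAction (H × Gᵐᵒᵖ) U] [MulAction (H × Gᵐᵒᵖ) U'] (h : GIso (K × Hᵐᵒᵖ) V V')
    (h' : GIso (H × Gᵐᵒᵖ) U U') : GIso (K × Gᵐᵒᵖ) (Comp K H G V U) (Comp K H G V' U') := by
  obtain ⟨e, he⟩ := h
  obtain ⟨f, hf⟩ := h'
  have he' : ∀ g v, e.symm (g • v) = g • e.symm v := fun g v => by
    rw [Equiv.symm_apply_eq, he, Equiv.apply_symm_apply]
  have hf' : ∀ g v, f.symm (g • v) = g • f.symm v := fun g v => by
    rw [Equiv.symm_apply_eq, hf, Equiv.apply_symm_apply]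
  refine ⟨⟨Comp.lift (fun v u => Comp.mk K H G (e v) (f u)) ?_,
    Comp.lift (fun v u => Comp.mk K H G (e.symm v) (f.symm u)) ?_, ?_, ?_⟩, ?_⟩
  · intro h v u
    rw [he, hf, Comp.mk_right_left]
  · intro h v u
    rw [he', hf', Comp.mk_right_left]
  · intro x
    induction x using Comp.ind with | h v u => simp
  · intro x
    induction x using Comp.ind with | h v u => simp
  · rintro ⟨k, g⟩ x
    induction x using Comp.ind with | h v u =>
    simp [Comp.smul_mk, he, hf]

theorem tens_congr {U U' X X' : Type} [MulAction (H × Gᵐᵒᵖ) U] [MulAction (H × Gᵐᵒᵖ) U']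
    [MulAction G X] [MulAction G X'] (h : GIso (H × Gᵐᵒᵖ) U U')
    (h' : GIso G X X') : GIso H (Tens H G U X) (Tens H G U' X') := by
  obtain ⟨e, he⟩ := h
  obtain ⟨f, hf⟩ := h'
  have he' : ∀ g v, e.symm (g • v) = g • e.symm v := fun g v => by
    rw [Equiv.symm_apply_eq, he, Equiv.apply_symm_apply]
  have hf' : ∀ g v, f.symm (g • v) = g • f.symm v := fun g v => by
    rw [Equiv.symm_apply_eq, hf, Equiv.apply_symm_apply]
  refine ⟨⟨Tens.lift (fun v u => Tens.mk H G (e v) (f u)) ?_,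
    Tens.lift (fun v u => Tens.mk H G (e.symm v) (f.symm u)) ?_, ?_, ?_⟩, ?_⟩
  · intro h v u
    rw [he, hf, Tens.mk_right_left]
  · intro h v u
    rw [he', hf', Tens.mk_right_left]
  · intro x
    induction x using Tens.ind with | h v u => simp
  · intro x
    induction x using Tens.ind with | h v u => simp
  · rintro g x
    induction x using Tens.ind with | h v u =>
    simp [Tens.smul_mk, he]

/-- Composition on classes of bisets, as a function. -/
def compFun (b : BisetClass K H) (a : BisetClass H G) : BisetClass K G :=
  lift (fun V _ _ => lift (fun U _ _ => GSetClass.mk (K × Gᵐᵒᵖ) (Comp K H G V U))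
    (fun U U' _ _ _ _ h => mk_eq_mk_iff.2 (comp_congr (GIso.refl V) h)) a)
    (fun V V' _ _ _ _ h => by
      induction a using GSetClass.ind with | h U =>
      rw [lift_mk, lift_mk]
      exact mk_eq_mk_iff.2 (comp_congr h (GIso.refl U))) b

theorem compFun_mk (V U : Type) [Finite V] [Finite U] [MulAction (K × Hᵐᵒᵖ) V]
    [MulAction (H × Gᵐᵒᵖ) U] :
    compFun (GSetClass.mk (K × Hᵐᵒᵖ) V) (GSetClass.mk (H × Gᵐᵒᵖ) U) =
      GSetClass.mk (K × Gᵐᵒᵖ) (Comp K H G V U) := by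
  rw [compFun, lift_mk, lift_mk]

/-- The action of classes of bisets on classes of sets, as a function. -/
def actFun (b : BisetClass H G) (a : GSetClass G) : GSetClass H :=
  lift (fun U _ _ => lift (fun X _ _ => GSetClass.mk H (Tens H G U X))
    (fun X X' _ _ _ _ h => mk_eq_mk_iff.2 (tens_congr (GIso.refl U) h)) a)
    (fun U U' _ _ _ _ h => by
      induction a using GSetClass.ind with | h X =>
      rw [lift_mk, lift_mk]
      exact mk_eq_mk_iff.2 (tens_congr h (GIso.refl X))) b

theorem actFun_mk (U X : Type) [Finite U] [Finite X] [MulAction (H × Gᵐᵒᵖ) U]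
    [MulAction G X] :
    actFun (GSetClass.mk (H × Gᵐᵒᵖ) U) (GSetClass.mk G X) = GSetClass.mk H (Tens H G U X) := by
  rw [actFun, lift_mk, lift_mk]

/-! Distributivity and associativity of these operations. -/

theorem compFun_add_left (b b' : BisetClass K H) (a : BisetClass H G) :
    compFun (b + b') a = compFun b a + compFun b' a := by
  induction b using GSetClass.ind with | h V =>
  induction b' using GSetClass.ind with | h V' =>
  induction a using GSetClass.ind with | h U =>
  simp only [mk_add, compFun_mk]
  refine mk_eq_mk ⟨Comp.lift (fun v u => Sum.elim (fun v => Sum.inl (Comp.mk K H G v u))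
      (fun v => Sum.inr (Comp.mk K H G v u)) v) ?_,
    Sum.elim (Comp.lift (fun v u => Comp.mk K H G (Sum.inl v) u) ?_)
      (Comp.lift (fun v u => Comp.mk K H G (Sum.inr v) u) ?_), ?_, ?_⟩ ?_
  · rintro h (v | v) u <;> simp [Comp.mk_right_left]
  · intro h v u
    rw [← Comp.mk_right_left, Sum.smul_inl]
  · intro h v u
    rw [← Comp.mk_right_left, Sum.smul_inr]
  · intro x
    induction x using Comp.ind with | h v u => rcases v with v | v <;> rfl
  · rintro (x | x) <;> induction x using Comp.ind with | h v u => rfl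
  · rintro ⟨k, g⟩ x
    induction x using Comp.ind with | h v u => rcases v with v | v <;> rfl

theorem compFun_add_right (b : BisetClass K H) (a a' : BisetClass H G) :
    compFun b (a + a') = compFun b a + compFun b a' := by
  induction b using GSetClass.ind with | h V =>
  induction a using GSetClass.ind with | h U =>
  induction a' using GSetClass.ind with | h U' =>
  simp only [mk_add, compFun_mk]
  refine mk_eq_mk ⟨Comp.lift (fun v u => Sum.elim (fun u => Sum.inl (Comp.mk K H G v u))
      (fun u => Sum.inr (Comp.mk K H G v u)) u) ?_,
    Sum.elim (Comp.lift (fun v u => Comp.mk K H G v (Sum.inl u)) ?_)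
      (Comp.lift (fun v u => Comp.mk K H G v (Sum.inr u)) ?_), ?_, ?_⟩ ?_
  · rintro h v (u | u) <;> simp [Comp.mk_right_left]
  · intro h v u
    rw [Comp.mk_right_left, Sum.smul_inl]
  · intro h v u
    rw [Comp.mk_right_left, Sum.smul_inr]
  · intro x
    induction x using Comp.ind with | h v u => rcases u with u | u <;> rfl
  · rintro (x | x) <;> induction x using Comp.ind with | h v u => rfl
  · rintro ⟨k, g⟩ x
    induction x using Comp.ind with | h v u => rcases u with u | u <;> rfl

theorem compFun_zero_left (a : BisetClass H G) : compFun (0 : BisetClass K H) a = 0 := by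
  induction a using GSetClass.ind with | h U =>
  simp only [zero_def, compFun_mk]
  have : IsEmpty (Comp K H G Empty U) := ⟨fun x => Comp.ind (P := fun _ => False) (fun v _ => v.elim) x⟩
  exact mk_eq_mk (Equiv.equivOfIsEmpty _ _) (fun g x => isEmptyElim x)

theorem compFun_zero_right (b : BisetClass K H) : compFun b (0 : BisetClass H G) = 0 := by
  induction b using GSetClass.ind with | h U =>
  simp only [zero_def, compFun_mk]
  have : IsEmpty (Comp K H G U Empty) := ⟨fun x => Comp.ind (P := fun _ => False) (fun _ v => v.elim) x⟩
  exact mk_eq_mk (Equiv.equivOfIsEmpty _ _) (fun g x => isEmptyElim x)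

theorem actFun_add_left (b b' : BisetClass H G) (a : GSetClass G) :
    actFun (b + b') a = actFun b a + actFun b' a := by
  induction b using GSetClass.ind with | h V =>
  induction b' using GSetClass.ind with | h V' =>
  induction a using GSetClass.ind with | h X =>
  simp only [mk_add, actFun_mk]
  refine mk_eq_mk ⟨Tens.lift (fun v u => Sum.elim (fun v => Sum.inl (Tens.mk H G v u))
      (fun v => Sum.inr (Tens.mk H G v u)) v) ?_,
    Sum.elim (Tens.lift (fun v u => Tens.mk H G (Sum.inl v) u) ?_)
      (Tens.lift (fun v u => Tens.mk H G (Sum.inr v) u) ?_), ?_, ?_⟩ ?_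
  · rintro h (v | v) u <;> simp [Tens.mk_right_left]
  · intro h v u
    rw [← Tens.mk_right_left, Sum.smul_inl]
  · intro h v u
    rw [← Tens.mk_right_left, Sum.smul_inr]
  · intro x
    induction x using Tens.ind with | h v u => rcases v with v | v <;> rfl
  · rintro (x | x) <;> induction x using Tens.ind with | h v u => rfl
  · rintro g x
    induction x using Tens.ind with | h v u => rcases v with v | v <;> rfl

theorem actFun_add_right (b : BisetClass H G) (a a' : GSetClass G) :
    actFun b (a + a') = actFun b a + actFun b a' := by
  induction b using GSetClass.ind with | h V =>
  induction a using GSetClass.ind with | h U =>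
  induction a' using GSetClass.ind with | h U' =>
  simp only [mk_add, actFun_mk]
  refine mk_eq_mk ⟨Tens.lift (fun v u => Sum.elim (fun u => Sum.inl (Tens.mk H G v u))
      (fun u => Sum.inr (Tens.mk H G v u)) u) ?_,
    Sum.elim (Tens.lift (fun v u => Tens.mk H G v (Sum.inl u)) ?_)
      (Tens.lift (fun v u => Tens.mk H G v (Sum.inr u)) ?_), ?_, ?_⟩ ?_
  · rintro h v (u | u) <;> simp [Tens.mk_right_left]
  · intro h v u
    rw [Tens.mk_right_left, Sum.smul_inl]
  · intro h v u
    rw [Tens.mk_right_left, Sum.smul_inr]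
  · intro x
    induction x using Tens.ind with | h v u => rcases u with u | u <;> rfl
  · rintro (x | x) <;> induction x using Tens.ind with | h v u => rfl
  · rintro g x
    induction x using Tens.ind with | h v u => rcases u with u | u <;> rfl

theorem actFun_zero_left (a : GSetClass G) : actFun (0 : BisetClass H G) a = 0 := by
  induction a using GSetClass.ind with | h U =>
  simp only [zero_def, actFun_mk]
  have : IsEmpty (Tens H G Empty U) := ⟨fun x => Tens.ind (P := fun _ => False) (fun v _ => v.elim) x⟩
  exact mk_eq_mk (Equiv.equivOfIsEmpty _ _) (fun g x => isEmptyElim x)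

theorem actFun_zero_right (b : BisetClass H G) : actFun b (0 : GSetClass G) = 0 := by
  induction b using GSetClass.ind with | h U =>
  simp only [zero_def, actFun_mk]
  have : IsEmpty (Tens H G U Empty) := ⟨fun x => Tens.ind (P := fun _ => False) (fun _ v => v.elim) x⟩
  exact mk_eq_mk (Equiv.equivOfIsEmpty _ _) (fun g x => isEmptyElim x)

/-- Composition of bisets, as a biadditive map on isomorphism classes. -/
def compClass : BisetClass K H →+ BisetClass H G →+ BisetClass K G where
  toFun b :=
    { toFun := compFun b
      map_zero' := compFun_zero_right b
      map_add' := compFun_add_right b }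
  map_zero' := by
    ext a
    exact compFun_zero_left a
  map_add' b b' := by
    ext a
    exact compFun_add_left b b' a

/-- The action of bisets on sets, as a biadditive map on isomorphism classes. -/
def actClass : BisetClass H G →+ GSetClass G →+ GSetClass H where
  toFun b :=
    { toFun := actFun b
      map_zero' := actFun_zero_right b
      map_add' := actFun_add_right b }
  map_zero' := by
    ext a
    exact actFun_zero_left a
  map_add' b b' := by
    ext a
    exact actFun_add_left b b' a

theorem compClass_mk (V U : Type) [Finite V] [Finite U] [MulAction (K × Hᵐᵒᵖ) V]
    [MulAction (H × Gᵐᵒᵖ) U] :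
    compClass (GSetClass.mk (K × Hᵐᵒᵖ) V) (GSetClass.mk (H × Gᵐᵒᵖ) U) =
      GSetClass.mk (K × Gᵐᵒᵖ) (Comp K H G V U) := compFun_mk V U

theorem actClass_mk (U X : Type) [Finite U] [Finite X] [MulAction (H × Gᵐᵒᵖ) U]
    [MulAction G X] :
    actClass (GSetClass.mk (H × Gᵐᵒᵖ) U) (GSetClass.mk G X) = GSetClass.mk H (Tens H G U X) :=
  actFun_mk U X

theorem compClass_assoc (c : BisetClass F K) (b : BisetClass K H) (a : BisetClass H G) :
    compClass (compClass c b) a = compClass c (compClass b a) := by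
  induction c using GSetClass.ind with | h W =>
  induction b using GSetClass.ind with | h V =>
  induction a using GSetClass.ind with | h U =>
  simp only [compClass_mk]
  refine mk_eq_mk ⟨Comp.lift (fun x u => Comp.lift
      (fun w v => Comp.mk F K G w (Comp.mk K H G v u)) ?_ x) ?_,
    Comp.lift (fun w x => Comp.lift (fun v u => Comp.mk F H G (Comp.mk F K H w v) u) ?_ x) ?_,
    ?_, ?_⟩ ?_
  · intro h w v
    rw [Comp.mk_right_left, Comp.smul_mk, ← Prod.one_eq_mk, one_smul]
  · intro h x u
    induction x using Comp.ind with | h w v =>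
    rw [Comp.smul_mk, Comp.lift_mk, Comp.lift_mk, Comp.mk_right_left, ← Prod.one_eq_mk, one_smul]
  · intro h v u
    rw [← Comp.mk_right_left, Comp.smul_mk, ← Prod.one_eq_mk, one_smul]
  · intro h w x
    induction x using Comp.ind with | h v u =>
    rw [Comp.smul_mk, Comp.lift_mk, Comp.lift_mk, Comp.mk_right_left, ← Prod.one_eq_mk, one_smul]
  · intro x
    induction x using Comp.ind with | h x u =>
    induction x using Comp.ind with | h w v => rfl
  · intro x
    induction x using Comp.ind with | h w x =>
    induction x using Comp.ind with | h v u => rfl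
  · rintro ⟨f, g⟩ x
    induction x using Comp.ind with | h x u =>
    induction x using Comp.ind with | h w v =>
    change Comp.mk F K G (((f, 1) : F × Kᵐᵒᵖ) • w) (Comp.mk K H G (((1, 1) : K × Hᵐᵒᵖ) • v)
      (((1, g) : H × Gᵐᵒᵖ) • u)) = Comp.mk F K G (((f, 1) : F × Kᵐᵒᵖ) • w)
      (Comp.mk K H G (((1, 1) : K × Hᵐᵒᵖ) • v) (((1, g) : H × Gᵐᵒᵖ) • u))
    rfl

theorem actClass_comp (c : BisetClass K H) (b : BisetClass H G) (a : GSetClass G) :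
    actClass (compClass c b) a = actClass c (actClass b a) := by
  induction c using GSetClass.ind with | h V =>
  induction b using GSetClass.ind with | h U =>
  induction a using GSetClass.ind with | h X =>
  simp only [compClass_mk, actClass_mk]
  refine mk_eq_mk ⟨Tens.lift (fun y x => Comp.lift
      (fun v u => Tens.mk K H v (Tens.mk H G u x)) ?_ y) ?_,
    Tens.lift (fun v y => Tens.lift (fun u x => Tens.mk K G (Comp.mk K H G v u) x) ?_ y) ?_,
    ?_, ?_⟩ ?_
  · intro h w v
    rw [Tens.mk_right_left, Tens.smul_mk]
  · intro h x u
    induction x using Comp.ind with | h w v =>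
    rw [Comp.smul_mk, Comp.lift_mk, Comp.lift_mk, Tens.mk_right_left, ← Prod.one_eq_mk, one_smul]
  · intro h v u
    rw [← Tens.mk_right_left, Comp.smul_mk, ← Prod.one_eq_mk, one_smul]
  · intro h w x
    induction x using Tens.ind with | h v u =>
    rw [Tens.smul_mk, Tens.lift_mk, Tens.lift_mk, Comp.mk_right_left]
  · intro x
    induction x using Tens.ind with | h x u =>
    induction x using Comp.ind with | h w v => rfl
  · intro x
    induction x using Tens.ind with | h w x =>
    induction x using Tens.ind with | h v u => rfl
  · rintro f x
    induction x using Tens.ind with | h x u =>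
    induction x using Comp.ind with | h w v =>
    change Tens.mk K H (((f, 1) : K × Hᵐᵒᵖ) • w) (Tens.mk H G (((1, 1) : H × Gᵐᵒᵖ) • v) u) =
      Tens.mk K H (((f, 1) : K × Hᵐᵒᵖ) • w) (Tens.mk H G v u)
    rw [← Prod.one_eq_mk, one_smul]

theorem compClass_id_left [Finite H] (a : BisetClass H G) : compClass (idClass H) a = a := by
  induction a using GSetClass.ind with | h U =>
  rw [idClass, compClass_mk]
  refine mk_eq_mk ⟨Comp.lift (fun (h : IdBiset H) u => ((h.val, 1) : H × Gᵐᵒᵖ) • u) ?_,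
    fun u => Comp.mk H H G ⟨1⟩ u, ?_, ?_⟩ ?_
  · intro h x u
    simp [smul_smul, idBiset_smul]
  · intro x
    induction x using Comp.ind with | h v u =>
    simp [← Comp.mk_right_left, idBiset_smul]
  · intro u
    simp [← Prod.one_eq_mk]
  · rintro ⟨h, g⟩ x
    induction x using Comp.ind with | h v u =>
    simp [Comp.smul_mk, smul_smul, idBiset_smul]

theorem compClass_id_right [Finite G] (a : BisetClass H G) : compClass a (idClass G) = a := by
  induction a using GSetClass.ind with | h U =>
  rw [idClass, compClass_mk]
  refine mk_eq_mk ⟨Comp.lift (fun u (g : IdBiset G) => ((1, op g.val) : H × Gᵐᵒᵖ) • u) ?_,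
    fun u => Comp.mk H G G u ⟨1⟩, ?_, ?_⟩ ?_
  · intro h u x
    simp [smul_smul, idBiset_smul]
  · intro x
    induction x using Comp.ind with | h v u =>
    simp [Comp.mk_right_left, idBiset_smul]
  · intro u
    simp [← Prod.one_eq_mk]
  · rintro ⟨h, g⟩ x
    induction x using Comp.ind with | h v u =>
    simp [Comp.smul_mk, smul_smul, idBiset_smul]

theorem actClass_id [Finite G] (a : GSetClass G) : actClass (idClass G) a = a := by
  induction a using GSetClass.ind with | h X =>
  rw [idClass, actClass_mk]
  refine mk_eq_mk ⟨Tens.lift (fun (g : IdBiset G) x => g.val • x) ?_,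
    fun u => Tens.mk G G ⟨1⟩ u, ?_, ?_⟩ ?_
  · intro h u x
    simp [smul_smul, idBiset_smul]
  · intro x
    induction x using Tens.ind with | h v u =>
    simp [← Tens.mk_right_left, idBiset_smul]
  · intro u
    simp
  · rintro g x
    induction x using Tens.ind with | h v u =>
    simp [Tens.smul_mk, smul_smul, idBiset_smul]

theorem opClass_id [Finite G] : opClass (idClass G) = idClass G := by
  rw [idClass, opClass_mk]
  refine mk_eq_mk ((OpBiset.equiv G G _).trans ((IdBiset.equiv G).trans
    ((Equiv.inv G).trans (IdBiset.equiv G).symm))) ?_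
  rintro ⟨g, h⟩ ⟨⟨x⟩⟩
  ext
  change (h.unop⁻¹ * x * g⁻¹)⁻¹ = g * x⁻¹ * h.unop
  simp [mul_assoc]

theorem opClass_opClass (a : BisetClass H G) : opClass (opClass a) = a := by
  induction a using GSetClass.ind with | h U =>
  rw [opClass_mk, opClass_mk]
  refine mk_eq_mk ((OpBiset.equiv G H _).trans (OpBiset.equiv H G U)) ?_
  rintro ⟨h, g⟩ ⟨⟨u⟩⟩
  simp [OpBiset.equiv, opBiset_smul]

theorem opClass_comp (b : BisetClass K H) (a : BisetClass H G) :
    opClass (compClass b a) = compClass (opClass a) (opClass b) := by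
  induction b using GSetClass.ind with | h V =>
  induction a using GSetClass.ind with | h U =>
  simp only [compClass_mk, opClass_mk]
  refine mk_eq_mk ((OpBiset.equiv K G (Comp K H G V U)).trans
    ⟨Comp.lift (fun v u => Comp.mk G H K ⟨u⟩ ⟨v⟩) ?_,
      Comp.lift (fun u v => Comp.mk K H G v.val u.val) ?_, ?_, ?_⟩) ?_
  · intro h v u
    have := Comp.mk_right_left (K := G) (G := K) h⁻¹ (⟨u⟩ : OpBiset H G U) (⟨v⟩ : OpBiset K H V)
    simpa [opBiset_smul] using this.symm
  · intro h u v
    have := Comp.mk_right_left (K := K) (G := G) h⁻¹ v.val u.val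
    simpa [opBiset_smul] using this.symm
  · intro x
    induction x using Comp.ind with | h v u => rfl
  · intro x
    induction x using Comp.ind with | h v u => rfl
  · rintro ⟨g, k⟩ ⟨x⟩
    induction x using Comp.ind with | h v u =>
    simp [OpBiset.equiv, opBiset_smul, Comp.smul_mk]

end Classes


/-! ### Marks -/

section Marks

variable {G : Type} [Group G]

/-- The set `X ^ K` of fixed points of a subgroup `K`. -/
abbrev Fix (K : Subgroup G) (X : Type) [MulAction G X] : Type := {x : X // ∀ k ∈ K, k • x = x}

/-- The number of `K`-fixed points, as a homomorphism of semirings. -/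
def fixCard (K : Subgroup G) : GSetClass G →+* ℕ where
  toFun := GSetClass.lift (fun X _ _ => Nat.card (Fix K X)) (fun X Y _ _ _ _ ⟨e, he⟩ =>
    Nat.card_congr (e.subtypeEquiv fun x => by simp [← he]))
  map_one' := by
    rw [GSetClass.one_def, GSetClass.lift_mk]
    have : Unique (Fix K Unit) := ⟨⟨⟨(), fun _ _ => rfl⟩⟩, fun _ => rfl⟩
    exact Nat.card_unique
  map_zero' := by
    rw [GSetClass.zero_def, GSetClass.lift_mk]
    simp
  map_add' a b := by
    induction a using GSetClass.ind with | h X =>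
    induction b using GSetClass.ind with | h Y =>
    simp only [GSetClass.mk_add, GSetClass.lift_mk]
    rw [← Nat.card_sum]
    refine Nat.card_congr (Equiv.subtypeSum.trans (Equiv.sumCongr ?_ ?_))
    · exact Equiv.subtypeEquivRight (by simp)
    · exact Equiv.subtypeEquivRight (by simp)
  map_mul' a b := by
    induction a using GSetClass.ind with | h X =>
    induction b using GSetClass.ind with | h Y =>
    simp only [GSetClass.mk_mul, GSetClass.lift_mk]
    rw [← Nat.card_prod]
    refine Nat.card_congr ((Equiv.subtypeEquivRight ?_).trans
      (Equiv.subtypeProdEquivProd (p := fun x : X => ∀ k ∈ K, k • x = x)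
        (q := fun y : Y => ∀ k ∈ K, k • y = y)))
    rintro ⟨x, y⟩
    simp only [Prod.smul_mk, Prod.mk.injEq]
    exact ⟨fun h => ⟨fun k hk => (h k hk).1, fun k hk => (h k hk).2⟩,
      fun h k hk => ⟨h.1 k hk, h.2 k hk⟩⟩

theorem fixCard_mk (K : Subgroup G) (X : Type) [Finite X] [MulAction G X] :
    fixCard K (GSetClass.mk G X) = Nat.card (Fix K X) := by
  simp only [fixCard, RingHom.coe_mk, MonoidHom.coe_mk, OneHom.coe_mk, GSetClass.lift_mk]

/-- The ring homomorphism `B(G) → ℤ`, `a ↦ |a ^ K|`, extending `[X] ↦ |X ^ K|`. -/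
def mark (K : Subgroup G) : Burnside G →+* ℤ :=
  Gro.liftRing ((Nat.castRingHom ℤ).comp (fixCard K))

theorem mark_of (K : Subgroup G) (x : GSetClass G) : mark K (Gro.of x) = fixCard K x := by
  simp [mark]

theorem mark_cls (K : Subgroup G) (X : Type) [Finite X] [MulAction G X] :
    mark K (cls G X) = Nat.card (Fix K X) := by
  rw [cls, mark_of, fixCard_mk]

/-- `∏ |a ^ (G_y)|`, where `y` runs through representatives of the orbits of `G` on `Y` and `G_y`
is the stabilizer of `y`; for `a = [X]`, this is the number of `G`-maps from `Y` to `X`. -/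
def orbitProd (Y : Type) [Finite Y] [MulAction G Y] : Burnside G →* ℤ where
  toFun a := ∏ᶠ ω : MulAction.orbitRel.Quotient G Y, mark (MulAction.stabilizer G ω.out) a
  map_one' := by simp
  map_mul' a b := by
    simp only [map_mul]
    exact finprod_mul_distrib (Set.toFinite _) (Set.toFinite _)

theorem orbitProd_apply (Y : Type) [Finite Y] [MulAction G Y] (a : Burnside G) :
    orbitProd Y a =
      ∏ᶠ ω : MulAction.orbitRel.Quotient G Y, mark (MulAction.stabilizer G ω.out) a := rfl

theorem orbitProd_cls (Y X : Type) [Finite Y] [Finite X] [MulAction G Y] [MulAction G X] :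
    orbitProd Y (cls G X) = Nat.card (Y →[G] X) := by
  let _ := Fintype.ofFinite (MulAction.orbitRel.Quotient G Y)
  rw [orbitProd_apply, finprod_eq_prod_of_fintype]
  simp only [mark_cls]
  rw [← Nat.cast_prod, ← Nat.card_pi]
  congr 1
  refine (Nat.card_eq_of_bijective (fun (f : Y →[G] X) (ω : MulAction.orbitRel.Quotient G Y) =>
    (⟨f ω.out, fun k hk => by rw [← map_smul, MulAction.mem_stabilizer_iff.1 hk]⟩ :
      Fix (MulAction.stabilizer G ω.out) X)) ⟨?_, ?_⟩).symm
  · intro f f' h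
    ext y
    obtain ⟨g, hg⟩ : ∃ g : G, g • (Quotient.mk (MulAction.orbitRel G Y) y).out = y :=
      (MulAction.orbitRel G Y).symm (Quotient.mk_out (s := MulAction.orbitRel G Y) y)
    have h1 := congrArg Subtype.val (congrFun h (Quotient.mk (MulAction.orbitRel G Y) y))
    rw [← hg, map_smul, map_smul]
    exact congrArg (g • ·) h1
  · intro s
    have hex : ∀ y : Y, ∃ g : G, g • (Quotient.mk (MulAction.orbitRel G Y) y).out = y := fun y =>
      (MulAction.orbitRel G Y).symm (Quotient.mk_out (s := MulAction.orbitRel G Y) y)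
    choose c hc using hex
    have key : ∀ (ω : MulAction.orbitRel.Quotient G Y) (g : G) (y : Y), g • ω.out = y →
        c y • (s (Quotient.mk (MulAction.orbitRel G Y) y)).1 = g • (s ω).1 := by
      intro ω g y hy
      have hω : ω = Quotient.mk (MulAction.orbitRel G Y) y := by
        rw [← Quotient.out_eq (s := MulAction.orbitRel G Y) ω]
        exact (Quotient.sound (s := MulAction.orbitRel G Y)
          (show y ∈ MulAction.orbit G ω.out from ⟨g, hy⟩)).symm
      subst hω
      have h1 : g⁻¹ * c y ∈
          MulAction.stabilizer G (Quotient.mk (MulAction.orbitRel G Y) y).out := by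
        rw [MulAction.mem_stabilizer_iff, mul_smul, hc, inv_smul_eq_iff, hy]
      have h2 := (s (Quotient.mk (MulAction.orbitRel G Y) y)).2 _ h1
      rw [mul_smul, inv_smul_eq_iff] at h2
      exact h2
    refine ⟨⟨fun y => c y • (s (Quotient.mk (MulAction.orbitRel G Y) y)).1, ?_⟩, ?_⟩
    · intro g y
      rw [key (Quotient.mk (MulAction.orbitRel G Y) y) (g * c y) (g • y)
        (by rw [mul_smul, hc]), mul_smul]
      rfl
    · funext ω
      ext
      have := key ω 1 ω.out (one_smul _ _)
      rw [one_smul] at this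
      exact this

/-- A function that respects congruences modulo every integer. -/
def Congruent (f : Burnside G → ℤ) : Prop :=
  ∀ (M : ℤ) (a c : Burnside G), M ∣ f (a + M • c) - f a

theorem congruent_mark (K : Subgroup G) : Congruent (fun a => mark K a) := by
  intro M a c
  simp

theorem congruent_orbitProd (Y : Type) [Finite Y] [MulAction G Y] :
    Congruent (fun a : Burnside G => orbitProd Y a) := by
  intro M a c
  let _ := Fintype.ofFinite (MulAction.orbitRel.Quotient G Y)
  simp only [orbitProd_apply, finprod_eq_prod_of_fintype]
  refine Int.ModEq.dvd (Int.ModEq.prod fun ω _ => ?_)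
  refine (Int.modEq_iff_dvd).2 ?_
  exact congruent_mark _ M a c

theorem exists_of_congruent (M : ℕ) (hM : 0 < M) (a : Burnside G) :
    ∃ (x : GSetClass G) (c : Burnside G), Gro.of x = a + (M : ℤ) • c := by
  induction a using Gro.ind with | h x y =>
  obtain ⟨m, rfl⟩ : ∃ m, M = m + 1 := ⟨M - 1, by omega⟩
  refine ⟨x + m • y, Gro.of y, ?_⟩
  rw [map_add, map_nsmul]
  push_cast
  rw [add_smul, one_smul, natCast_zsmul]
  abel

theorem congruent_ext {f f' : Burnside G → ℤ} (hf : Congruent f) (hf' : Congruent f')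
    (h : ∀ (X : Type) [Finite X] [MulAction G X], f (cls G X) = f' (cls G X)) : f = f' := by
  funext a
  have h' : ∀ x : GSetClass G, f (Gro.of x) = f' (Gro.of x) := fun x => by
    induction x using GSetClass.ind with | h X => exact h X
  obtain ⟨x, c, hx⟩ := exists_of_congruent ((f' a - f a).natAbs + 1) (Nat.succ_pos _) a
  have h1 := hf (((f' a - f a).natAbs + 1 : ℕ) : ℤ) a c
  have h2 := hf' (((f' a - f a).natAbs + 1 : ℕ) : ℤ) a c
  rw [← hx] at h1 h2
  rw [h' x] at h1
  have h3 := dvd_sub h1 h2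
  have h4 : f' (Gro.of x) - f a - (f' (Gro.of x) - f' a) = f' a - f a := by ring
  rw [h4] at h3
  have h5 := Int.eq_zero_of_abs_lt_dvd h3 (by rw [Int.abs_eq_natAbs]; push_cast; omega)
  omega

theorem orbitProd_congr {Y Y' : Type} [Finite Y] [Finite Y'] [MulAction G Y] [MulAction G Y']
    (h : GIso G Y Y') : (orbitProd Y : Burnside G →* ℤ) = orbitProd Y' := by
  obtain ⟨e, he⟩ := h
  have he' : ∀ (g : G) y, e.symm (g • y) = g • e.symm y := fun g v => by
    rw [Equiv.symm_apply_eq, he, Equiv.apply_symm_apply]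
  refine DFunLike.coe_injective
    (congruent_ext (congruent_orbitProd Y) (congruent_orbitProd Y') ?_)
  intro X _ _
  rw [orbitProd_cls, orbitProd_cls]
  congr 1
  exact Nat.card_congr
    ⟨fun f => ⟨fun y => f (e.symm y), fun g y => by rw [he', map_smul]; rfl⟩,
      fun f => ⟨fun y => f (e y), fun g y => by rw [he, map_smul]; rfl⟩,
      fun f => MulActionHom.ext fun y => congrArg f (e.symm_apply_apply y),
      fun f => MulActionHom.ext fun y => congrArg f (e.apply_symm_apply y)⟩

/-- The invariant `orbitProd`, as a function of the isomorphism class. -/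
def orbitProdClass : GSetClass G → (Burnside G →* ℤ) :=
  GSetClass.lift (fun Y _ _ => orbitProd Y) (fun _ _ _ _ _ _ h => orbitProd_congr h)

theorem orbitProdClass_mk (Y : Type) [Finite Y] [MulAction G Y] :
    orbitProdClass (GSetClass.mk G Y) = orbitProd Y := GSetClass.lift_mk _ _ _

theorem orbitProdClass_add (y y' : GSetClass G) :
    orbitProdClass (y + y') = orbitProdClass y * orbitProdClass y' := by
  induction y using GSetClass.ind with | h Y =>
  induction y' using GSetClass.ind with | h Y' =>
  rw [GSetClass.mk_add, orbitProdClass_mk, orbitProdClass_mk, orbitProdClass_mk]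
  refine DFunLike.coe_injective
    (congruent_ext (congruent_orbitProd (Y ⊕ Y')) (f' := fun a => orbitProd Y a * orbitProd Y' a)
      ?_ ?_)
  · intro M a c
    exact ((Int.modEq_iff_dvd.2 (congruent_orbitProd Y M a c)).mul
      (Int.modEq_iff_dvd.2 (congruent_orbitProd Y' M a c))).dvd
  · intro X _ _
    rw [orbitProd_cls, orbitProd_cls, orbitProd_cls, ← Nat.cast_mul, ← Nat.card_prod]
    congr 1
    refine Nat.card_congr
      ⟨fun f => (⟨fun y => f (Sum.inl y), fun g y => by rw [← Sum.smul_inl, map_smul]; rfl⟩,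
          ⟨fun y => f (Sum.inr y), fun g y => by rw [← Sum.smul_inr, map_smul]; rfl⟩),
        fun p => ⟨Sum.elim p.1 p.2, fun g y => by rcases y with y | y <;> simp⟩,
        fun f => by ext (y | y) <;> rfl, fun p => rfl⟩

theorem orbitProdClass_zero : orbitProdClass (0 : GSetClass G) = 1 := by
  rw [GSetClass.zero_def, orbitProdClass_mk]
  ext a
  rw [orbitProd_apply]
  have : IsEmpty (MulAction.orbitRel.Quotient G Empty) :=
    ⟨fun x => (Quotient.out (s := MulAction.orbitRel G Empty) x).elim⟩
  exact finprod_of_isEmpty _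

theorem orbitProd_quotient [Finite G] (K : Subgroup G) (a : Burnside G) :
    orbitProd (G ⧸ K) a = mark K a := by
  refine congrFun (congruent_ext (congruent_orbitProd (G ⧸ K)) (congruent_mark K) ?_) a
  intro X _ _
  rw [orbitProd_cls, mark_cls]
  congr 1
  refine Nat.card_congr
    ⟨fun f => ⟨f ((1 : G) : G ⧸ K), fun k hk => ?_⟩,
      fun x => ⟨Quotient.lift (fun g : G => g • x.1) ?_, ?_⟩, ?_, ?_⟩
  · rw [← map_smul]
    congr 1
    exact QuotientGroup.eq.2 (by simpa using hk)
  · intro g g' h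
    have := x.2 _ (QuotientGroup.leftRel_apply.1 h)
    change g • x.1 = g' • x.1
    rw [mul_smul, inv_smul_eq_iff] at this
    exact this.symm
  · intro g y
    induction y using QuotientGroup.induction_on with | H y =>
    exact mul_smul g y x.1
  · intro f
    ext y
    induction y using QuotientGroup.induction_on with | H y =>
    change y • f ((1 : G) : G ⧸ K) = _
    rw [← map_smul]
    congr 1
    change ((y * 1 : G) : G ⧸ K) = _
    rw [mul_one]
  · intro x
    ext
    exact one_smul G x.1

end Marks


section Burnside

variable {G : Type} [Group G] [Finite G]

/-! ### Decomposition into orbits, and the injectivity of the marks -/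

theorem exists_split (X : Type) [Finite X] [MulAction G X] (x : X) :
    ∃ (Z : Type) (_ : Finite Z) (_ : MulAction G Z),
      GSetClass.mk G X = GSetClass.mk G (G ⧸ MulAction.stabilizer G x) + GSetClass.mk G Z ∧
      Nat.card Z < Nat.card X := by
  let S : SubMulAction G X :=
    { carrier := (MulAction.orbit G x)ᶜ
      smul_mem' := fun g y hy hgy => hy (by
        have := MulAction.mem_orbit_of_mem_orbit g⁻¹ hgy
        rwa [inv_smul_smul] at this) }
  have hS : ∀ y : X, y ∈ S ↔ y ∉ MulAction.orbit G x := fun y => Iff.rfl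
  refine ⟨S, inferInstance, inferInstance, ?_, ?_⟩
  · rw [GSetClass.mk_add]
    refine GSetClass.mk_eq_mk_iff.2 (GIso.symm ⟨Equiv.ofBijective
      (Sum.elim (MulAction.ofQuotientStabilizer G x) Subtype.val) ⟨?_, ?_⟩, ?_⟩)
    · rw [Sum.elim_injective]
      refine ⟨MulAction.injective_ofQuotientStabilizer G x, Subtype.val_injective, ?_⟩
      intro a b h
      exact (hS b.1).1 b.2 (h ▸ MulAction.ofQuotientStabilizer_mem_orbit G x a)
    · intro y
      by_cases hy : y ∈ MulAction.orbit G x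
      · obtain ⟨g, rfl⟩ := hy
        exact ⟨Sum.inl (g : G ⧸ MulAction.stabilizer G x), rfl⟩
      · exact ⟨Sum.inr ⟨y, hy⟩, rfl⟩
    · rintro g (y | y)
      · exact MulAction.ofQuotientStabilizer_smul G x g y
      · rfl
  · exact Finite.card_subtype_lt (p := fun y => y ∈ S) (x := x)
      (fun h => (hS x).1 h (MulAction.mem_orbit_self x))

theorem gset_ind {P : GSetClass G → Prop} (h0 : P 0)
    (hK : ∀ K : Subgroup G, P (GSetClass.mk G (G ⧸ K)))
    (hadd : ∀ a b, P a → P b → P (a + b)) (a : GSetClass G) : P a := by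
  induction a using GSetClass.ind with | h X =>
  obtain ⟨n, hn⟩ : ∃ n, Nat.card X = n := ⟨_, rfl⟩
  induction n using Nat.strong_induction_on generalizing X with | _ n ih =>
  rcases isEmpty_or_nonempty X with hX | ⟨⟨x⟩⟩
  · have : GSetClass.mk G X = 0 :=
      GSetClass.mk_eq_mk (Equiv.equivOfIsEmpty _ _) (fun g x => isEmptyElim x)
    rwa [this]
  · obtain ⟨Z, _, _, h, hlt⟩ := exists_split (G := G) X x
    rw [h]
    exact hadd _ _ (hK _) (ih _ (hn ▸ hlt) Z rfl)

theorem gset_ext {a b : GSetClass G} (h : ∀ K : Subgroup G, fixCard K a = fixCard K b) :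
    a = b := by
  induction a using GSetClass.ind with | h X =>
  induction b using GSetClass.ind with | h Y =>
  obtain ⟨n, hn⟩ : ∃ n, Nat.card X = n := ⟨_, rfl⟩
  induction n using Nat.strong_induction_on generalizing X Y with | _ n ih =>
  have hne : ∀ (Z : Type) [Finite Z] [MulAction G Z] (K : Subgroup G),
      0 < fixCard K (GSetClass.mk G Z) ↔ ∃ z : Z, K ≤ MulAction.stabilizer G z := by
    intro Z _ _ K
    rw [fixCard_mk, Nat.card_pos_iff]
    exact ⟨fun ⟨⟨z⟩, _⟩ => ⟨z.1, fun k hk => z.2 k hk⟩,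
      fun ⟨z, hz⟩ => ⟨⟨⟨z, fun k hk => hz hk⟩⟩, inferInstance⟩⟩
  rcases isEmpty_or_nonempty X with hX | ⟨⟨x0⟩⟩
  · have hY : IsEmpty Y := by
      by_contra hY
      rw [not_isEmpty_iff] at hY
      obtain ⟨y⟩ := hY
      have h1 := (hne Y ⊥).2 ⟨y, bot_le⟩
      rw [← h] at h1
      obtain ⟨x, _⟩ := (hne X ⊥).1 h1
      exact hX.elim x
    exact GSetClass.mk_eq_mk (Equiv.equivOfIsEmpty _ _) (fun g x => isEmptyElim x)
  · obtain ⟨K, hK, hmax⟩ := Set.exists_max_image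
      {K : Subgroup G | 0 < fixCard K (GSetClass.mk G X)} (fun K => Nat.card K)
      (Set.toFinite _) ⟨⊥, (hne X ⊥).2 ⟨x0, bot_le⟩⟩
    obtain ⟨x, hx⟩ := (hne X K).1 hK
    have hK' := hK
    change 0 < fixCard K (GSetClass.mk G X) at hK'
    rw [h] at hK'
    obtain ⟨y, hy⟩ := (hne Y K).1 hK'
    have hx' : K = MulAction.stabilizer G x :=
      Subgroup.eq_of_le_of_card_ge hx (hmax _ ((hne X _).2 ⟨x, le_rfl⟩))
    have hy' : K = MulAction.stabilizer G y :=
      Subgroup.eq_of_le_of_card_ge hy (hmax _ (by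
        change 0 < fixCard _ (GSetClass.mk G X)
        rw [h]
        exact (hne Y _).2 ⟨y, le_rfl⟩))
    obtain ⟨X', _, _, h1, hlt⟩ := exists_split (G := G) X x
    obtain ⟨Y', _, _, h2, _⟩ := exists_split (G := G) Y y
    rw [← hx'] at h1
    rw [← hy'] at h2
    rw [h1, h2, ih _ (hn ▸ hlt) X' Y' (fun L => ?_) rfl]
    have := h L
    rw [h1, h2, map_add, map_add] at this
    omega

/-- Burnside's theorem: elements of the Burnside ring are determined by their marks. -/
theorem burnside_ext {a b : Burnside G} (h : ∀ K : Subgroup G, mark K a = mark K b) :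
    a = b := by
  induction a using Gro.ind with | h x y =>
  induction b using Gro.ind with | h z w =>
  have : x + w = z + y := gset_ext fun K => by
    have h1 := h K
    simp only [map_sub, mark_of] at h1
    rw [map_add, map_add]
    omega
  rw [sub_eq_sub_iff_add_eq_add, ← map_add, ← map_add, this]

theorem burnside_ext' {a b : Burnside G}
    (h : ∀ z : GSetClass G, orbitProdClass z a = orbitProdClass z b) : a = b :=
  burnside_ext fun K => by
    rw [← orbitProd_quotient, ← orbitProd_quotient, ← orbitProdClass_mk, h]

/-! ### Elements of the Burnside ring with prescribed marks -/

theorem fix_quotient {L K : Subgroup G} (hc : Nat.card K ≤ Nat.card L) (x : Fix L (G ⧸ K)) :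
    GIso G (G ⧸ L) (G ⧸ K) ∧ Nat.card K = Nat.card L := by
  have hle : L ≤ MulAction.stabilizer G x.1 := fun l hl => x.2 l hl
  have hb : Function.Bijective (MulAction.ofQuotientStabilizer G x.1) := by
    refine ⟨MulAction.injective_ofQuotientStabilizer G x.1, fun y => ?_⟩
    obtain ⟨g, hg⟩ := MulAction.exists_smul_eq G x.1 y
    exact ⟨(g : G ⧸ MulAction.stabilizer G x.1), hg⟩
  have hcard := Nat.card_eq_of_bijective _ hb
  have h1 := Subgroup.card_eq_card_quotient_mul_card_subgroup K
  have h2 := Subgroup.card_eq_card_quotient_mul_card_subgroup (MulAction.stabilizer G x.1)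
  rw [hcard, h1] at h2
  have h3 : Nat.card K = Nat.card (MulAction.stabilizer G x.1) :=
    Nat.eq_of_mul_eq_mul_left Nat.card_pos h2
  have h4 : L = MulAction.stabilizer G x.1 := Subgroup.eq_of_le_of_card_ge hle (h3 ▸ hc)
  rw [← h4] at h3
  refine ⟨?_, h3⟩
  rw [h4]
  exact ⟨Equiv.ofBijective _ hb, fun g y => MulAction.ofQuotientStabilizer_smul G x.1 g y⟩

open Classical in
theorem sum_fix_quotient (L : Subgroup G) [Fintype (Subgroup G)] :
    ∑ K : Subgroup G with Nat.card (K : Subgroup G) = Nat.card L, Nat.card L * Nat.card (Fix L (G ⧸ K)) =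
      Nat.card G := by
  have h1 : ∀ K : Subgroup G, Nat.card K = Nat.card L →
      Nat.card L * Nat.card (Fix L (G ⧸ K)) =
        Nat.card {g : G // K = L.map (MulAut.conj g⁻¹).toMonoidHom} := by
    intro K hK
    rw [← hK, ← Nat.card_prod]
    refine Nat.card_congr ((QuotientGroup.preimageMkEquivSubgroupProdSet K
      {x : G ⧸ K | ∀ l ∈ L, l • x = x}).symm.trans (Equiv.subtypeEquivRight fun g => ?_))
    have hmem : (∀ l ∈ L, l • (g : G ⧸ K) = g) ↔ L.map (MulAut.conj g⁻¹).toMonoidHom ≤ K := by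
      rw [Subgroup.map_le_iff_le_comap]
      refine forall₂_congr fun l hl => ?_
      rw [Subgroup.mem_comap]
      change ((l * g : G) : G ⧸ K) = g ↔ _
      rw [eq_comm, QuotientGroup.eq]
      simp [mul_assoc]
    change (∀ l ∈ L, l • (g : G ⧸ K) = g) ↔ _
    rw [hmem]
    have hcard : Nat.card (L.map (MulAut.conj g⁻¹).toMonoidHom) = Nat.card L :=
      Subgroup.card_map_of_injective (MulAut.conj g⁻¹).injective
    exact ⟨fun h => (Subgroup.eq_of_le_of_card_ge h (by rw [hcard, hK])).symm, fun h => h.ge⟩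
  rw [Finset.sum_congr rfl fun K hK => h1 K (Finset.mem_filter.1 hK).2]
  have h2 : ∀ K : Subgroup G, Nat.card K ≠ Nat.card L →
      Nat.card {g : G // K = L.map (MulAut.conj g⁻¹).toMonoidHom} = 0 := by
    intro K hK
    rw [Nat.card_eq_zero]
    left
    refine ⟨fun g => hK ?_⟩
    rw [g.2]
    exact Subgroup.card_map_of_injective (MulAut.conj g.1⁻¹).injective
  rw [Finset.sum_filter_of_ne (fun K _ hK => by
    by_contra h
    exact hK (h2 K h)), ← Nat.card_sigma]
  exact Nat.card_congr ⟨fun p => p.2.1, fun g => ⟨_, g, rfl⟩,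
    fun ⟨K, g, h⟩ => by subst h; rfl, fun g => rfl⟩

theorem mark_congr {K L : Subgroup G} (h : GIso G (G ⧸ K) (G ⧸ L)) (a : Burnside G) :
    mark K a = mark L a := by
  rw [← orbitProd_quotient, ← orbitProd_quotient, orbitProd_congr h]

open Classical in
theorem exists_marks_aux (n : ℕ) : ∀ f : Subgroup G → ℤ,
    (∀ K L, GIso G (G ⧸ K) (G ⧸ L) → f K = f L) → (∀ K, (Nat.card G : ℤ) ^ n ∣ f K) →
    (∀ K : Subgroup G, n < Nat.card K → f K = 0) → ∃ c : Burnside G, ∀ K, mark K c = f K := by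
  induction n with
  | zero =>
    intro f _ _ h0
    exact ⟨0, fun K => by rw [map_zero, h0 K Nat.card_pos]⟩
  | succ n ih =>
    intro f hf hd h0
    let _ := Fintype.ofFinite (Subgroup G)
    choose q hq using hd
    have hpos : (Nat.card G : ℤ) ≠ 0 := by exact_mod_cast Nat.card_pos.ne'
    have hq' : ∀ K L, GIso G (G ⧸ K) (G ⧸ L) → q K = q L := fun K L h => by
      have := hf K L h
      rw [hq, hq] at this
      exact mul_left_cancel₀ (pow_ne_zero _ hpos) this
    let c0 : Burnside G := ∑ K : Subgroup G with Nat.card (K : Subgroup G) = n + 1,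
      ((Nat.card G : ℤ) ^ n * q K * (n + 1 : ℕ)) • cls G (G ⧸ K)
    have hc0 : ∀ L, mark L c0 = ∑ K : Subgroup G with Nat.card (K : Subgroup G) = n + 1,
        ((Nat.card G : ℤ) ^ n * q K * (n + 1 : ℕ)) * Nat.card (Fix L (G ⧸ K)) := fun L => by
      simp only [c0, map_sum, map_zsmul, mark_cls, smul_eq_mul]
    suffices h : ∃ c : Burnside G, ∀ K, mark K c = f K - mark K c0 by
      obtain ⟨c, hc⟩ := h
      exact ⟨c + c0, fun K => by rw [map_add, hc]; ring⟩
    refine ih (fun K => f K - mark K c0) ?_ ?_ ?_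
    · intro K L h
      rw [hf K L h, mark_congr h]
    · intro L
      refine dvd_sub ?_ ?_
      · rw [hq]
        exact Dvd.dvd.mul_right (pow_dvd_pow _ (Nat.le_succ n)) _
      · rw [hc0]
        refine Finset.dvd_sum fun K _ => ?_
        rw [mul_assoc, mul_assoc]
        exact Dvd.intro _ rfl
    · intro L hL
      rcases Nat.lt_or_ge (n + 1) (Nat.card L) with h | h
      · rw [h0 L h, hc0, Finset.sum_eq_zero, sub_zero]
        intro K hK
        have hK := (Finset.mem_filter.1 hK).2
        have : IsEmpty (Fix L (G ⧸ K)) := ⟨fun x => by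
          have := (fix_quotient (by omega) x).2
          omega⟩
        simp
      · have hL' : Nat.card L = n + 1 := by omega
        have h1 : mark L c0 = ∑ K : Subgroup G with Nat.card (K : Subgroup G) = Nat.card L,
            ((Nat.card G : ℤ) ^ n * q L) *
              ((Nat.card L * Nat.card (Fix L (G ⧸ K)) : ℕ) : ℤ) := by
          rw [hc0, hL']
          refine Finset.sum_congr rfl fun K hK => ?_
          have hK := (Finset.mem_filter.1 hK).2
          rcases isEmpty_or_nonempty (Fix L (G ⧸ K)) with hE | ⟨⟨x⟩⟩
          · simp
          · rw [hq' L K (fix_quotient (by omega) x).1]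
            push_cast
            ring
        rw [h1, ← Finset.mul_sum, ← Nat.cast_sum, sum_fix_quotient, hq]
        ring

theorem exists_marks (f : Subgroup G → ℤ)
    (hf : ∀ K L, GIso G (G ⧸ K) (G ⧸ L) → f K = f L)
    (hd : ∀ K, ((Nat.card G ^ Nat.card G : ℕ) : ℤ) ∣ f K) :
    ∃ c : Burnside G, ∀ K, mark K c = f K :=
  exists_marks_aux (Nat.card G) f hf (fun K => by simpa using hd K) fun K hK =>
    absurd hK (not_lt.2 (Nat.card_le_card_of_injective _ K.subtype_injective))

end Burnside

/-! ### Tensor induction -/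

section TensorInduction

variable {K H G : Type} [Group K] [Group H] [Group G]

section HomSet

variable (H G) (U X : Type) [MulAction (H × Gᵐᵒᵖ) U] [MulAction G X]

/-- The set `Hom_G(Uᵒᵖ, X)` of `G`-maps `Uᵒᵖ → X`, i.e. of maps `f : U → X` such that
`f (u g) = g⁻¹ f(u)`, for an `(H, G)`-biset `U` and a `G`-set `X`. -/
@[ext]
structure HomSet : Type where
  toFun : U → X
  map_right : ∀ (g : G) (u : U), toFun (((1, op g) : H × Gᵐᵒᵖ) • u) = g⁻¹ • toFun u

instance [Finite U] [Finite X] : Finite (HomSet H G U X) :=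
  Finite.of_injective HomSet.toFun fun _ _ h => HomSet.ext h

/-- `H` acts on `Hom_G(Uᵒᵖ, X)` by `(h f)(u) = f (h⁻¹ u)`. -/
instance : MulAction H (HomSet H G U X) where
  smul h f := ⟨fun u => f.toFun (((h⁻¹, 1) : H × Gᵐᵒᵖ) • u), fun g u => by
    rw [left_right_comm, f.map_right]⟩
  one_smul f := HomSet.ext (funext fun u => by
    change f.toFun ((((1 : H)⁻¹, 1) : H × Gᵐᵒᵖ) • u) = f.toFun u
    simp [← Prod.one_eq_mk])
  mul_smul h h' f := HomSet.ext (funext fun u => by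
    change f.toFun ((((h * h')⁻¹, 1) : H × Gᵐᵒᵖ) • u) =
      f.toFun (((h'⁻¹, 1) : H × Gᵐᵒᵖ) • ((h⁻¹, 1) : H × Gᵐᵒᵖ) • u)
    simp [smul_smul])

theorem homSet_smul (h : H) (f : HomSet H G U X) (u : U) :
    (h • f).toFun u = f.toFun (((h⁻¹, 1) : H × Gᵐᵒᵖ) • u) := rfl

theorem card_hom_homSet (Z : Type) [MulAction H Z] :
    Nat.card (Z →[H] HomSet H G U X) = Nat.card (Tens G H (OpBiset H G U) Z →[G] X) := by
  refine Nat.card_congr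
    ⟨fun φ => ⟨Tens.lift (fun u z => (φ z).toFun u.val) ?_, ?_⟩,
      fun ψ => ⟨fun z => ⟨fun u => ψ (Tens.mk G H ⟨u⟩ z), ?_⟩, ?_⟩, ?_, ?_⟩
  · intro h u z
    rw [map_smul, homSet_smul, opBiset_smul]
    simp
  · intro g x
    induction x using Tens.ind with | h u z =>
    rw [Tens.smul_mk, Tens.lift_mk, Tens.lift_mk, opBiset_smul]
    have := (φ z).map_right g⁻¹ u.val
    simpa using this
  · intro g u
    rw [← map_smul, Tens.smul_mk, opBiset_smul]
    simp
  · intro h z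
    refine HomSet.ext (funext fun u => ?_)
    change ψ (Tens.mk G H ⟨u⟩ (h • z)) = ψ (Tens.mk G H ⟨((h⁻¹, 1) : H × Gᵐᵒᵖ) • u⟩ z)
    rw [← Tens.mk_right_left, opBiset_smul]
    simp
  · intro φ
    rfl
  · intro ψ
    refine MulActionHom.ext fun x => ?_
    induction x using Tens.ind with | h u z => rfl

end HomSet

variable [Finite H]

theorem exists_tensorInd (u : BisetClass H G) (a : Burnside G) :
    ∃ b : Burnside H, ∀ z : GSetClass H,
      orbitProdClass z b = orbitProdClass (actClass (opClass u) z) a := by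
  induction u using GSetClass.ind with | h U =>
  obtain ⟨x, y, hx⟩ := exists_of_congruent (Nat.card H ^ Nat.card H) (pow_pos Nat.card_pos _) a
  induction x using GSetClass.ind with | h X =>
  let f : Subgroup H → ℤ := fun K => orbitProdClass
    (actClass (opClass (GSetClass.mk (H × Gᵐᵒᵖ) U)) (GSetClass.mk H (H ⧸ K))) a
  suffices h : ∃ c : Burnside H, ∀ K, mark K c = f K - mark K (cls H (HomSet H G U X)) by
    obtain ⟨c, hc⟩ := h
    refine ⟨cls H (HomSet H G U X) + c, fun z => ?_⟩
    induction z using gset_ind with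
    | h0 => rw [map_zero, orbitProdClass_zero, orbitProdClass_zero]; rfl
    | hK K =>
      rw [orbitProdClass_mk, orbitProd_quotient, map_add, hc]
      simp only [f]
      ring
    | hadd z z' hz hz' =>
      rw [map_add (actClass _), orbitProdClass_add, orbitProdClass_add, MonoidHom.mul_apply,
        MonoidHom.mul_apply, hz, hz']
  refine exists_marks (fun K => f K - mark K (cls H (HomSet H G U X))) ?_ ?_
  · intro K L h
    simp only [f]
    rw [GSetClass.mk_eq_mk_iff.2 h, mark_congr h]
  · intro K
    have h1 : mark K (cls H (HomSet H G U X)) = orbitProd (Tens G H (OpBiset H G U) (H ⧸ K))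
        (cls G X) := by
      rw [← orbitProd_quotient, orbitProd_cls, orbitProd_cls, card_hom_homSet]
    simp only [f]
    rw [h1, opClass_mk, actClass_mk, orbitProdClass_mk, cls, hx, dvd_sub_comm]
    exact congruent_orbitProd _ _ _ _

/-- Tensor induction `B(G) → B(H)` along (the class of) an `(H, G)`-biset `U`: the multiplicative
map `b = T_U(a)` characterized by `∏_{z ∈ H\Z} |b ^ (H_z)| = ∏_{y ∈ G\(Uᵒᵖ ×_H Z)} |a ^ (G_y)|`
for all finite `H`-sets `Z`. It extends the map `[X] ↦ [Hom_G(Uᵒᵖ, X)]`, see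
`tensorInd_cls`. -/
def tensorInd (u : BisetClass H G) : Burnside G →* Burnside H where
  toFun a := (exists_tensorInd u a).choose
  map_one' := burnside_ext' fun z => by
    rw [(exists_tensorInd u 1).choose_spec, map_one, map_one]
  map_mul' a b := burnside_ext' fun z => by
    rw [(exists_tensorInd u (a * b)).choose_spec, map_mul, map_mul,
      (exists_tensorInd u a).choose_spec, (exists_tensorInd u b).choose_spec]

theorem tensorInd_spec (u : BisetClass H G) (a : Burnside G) (z : GSetClass H) :
    orbitProdClass z (tensorInd u a) = orbitProdClass (actClass (opClass u) z) a :=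
  (exists_tensorInd u a).choose_spec z

/-- On a finite `G`-set `X`, tensor induction is given by `X ↦ Hom_G(Uᵒᵖ, X)`. -/
theorem tensorInd_cls (U X : Type) [Finite U] [Finite X] [MulAction (H × Gᵐᵒᵖ) U]
    [MulAction G X] :
    tensorInd (GSetClass.mk (H × Gᵐᵒᵖ) U) (cls G X) = cls H (HomSet H G U X) :=
  burnside_ext' fun z => by
    induction z using GSetClass.ind with | h Z =>
    rw [tensorInd_spec, opClass_mk, actClass_mk, orbitProdClass_mk, orbitProdClass_mk,
      orbitProd_cls, orbitProd_cls, card_hom_homSet]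

theorem tensorInd_zero (a : Burnside G) : tensorInd (0 : BisetClass H G) a = 1 :=
  burnside_ext' fun z => by
    rw [tensorInd_spec, map_zero, map_zero, AddMonoidHom.zero_apply, orbitProdClass_zero, map_one]
    rfl

theorem tensorInd_add (u u' : BisetClass H G) (a : Burnside G) :
    tensorInd (u + u') a = tensorInd u a * tensorInd u' a :=
  burnside_ext' fun z => by
    rw [tensorInd_spec, map_add, map_add, AddMonoidHom.add_apply, orbitProdClass_add, map_mul,
      tensorInd_spec, tensorInd_spec]
    rfl

theorem tensorInd_id (a : Burnside H) : tensorInd (idClass H) a = a :=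
  burnside_ext' fun z => by
    rw [tensorInd_spec, opClass_id, actClass_id]

theorem tensorInd_comp [Finite K] (v : BisetClass K H) (u : BisetClass H G) (a : Burnside G) :
    tensorInd (compClass v u) a = tensorInd v (tensorInd u a) :=
  burnside_ext' fun z => by
    rw [tensorInd_spec, opClass_comp, actClass_comp, tensorInd_spec, tensorInd_spec]

end TensorInduction


/-! ### Units of Burnside rings -/

section Units

variable {G : Type} [Group G]

/-- The group of units `B(G)ˣ` of the Burnside ring, written additively. -/
abbrev UnitGroup (G : Type) [Group G] : Type := Additive (Burnside G)ˣ

theorem unit_mul_self [Finite G] (u : (Burnside G)ˣ) : u * u = 1 := by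
  refine Units.ext (burnside_ext fun K => ?_)
  rw [Units.val_mul, map_mul, Units.val_one, map_one]
  exact Int.isUnit_mul_self (u.isUnit.map (mark K))

/-- `B(G)ˣ` is an elementary abelian `2`-group, i.e. a vector space over `𝔽₂`. -/
instance [Finite G] : Module (ZMod 2) (UnitGroup G) :=
  AddCommGroup.zmodModule fun u => by
    rw [two_nsmul]
    exact congrArg Additive.ofMul (unit_mul_self u.toMul)

/-- The isomorphism `s ↦ s₊` from `{±1}` to the additive group of `𝔽₂`. -/
def signPlus : Additive ℤˣ →+ ZMod 2 where
  toFun s := if s.toMul = 1 then 0 else 1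
  map_zero' := by simp
  map_add' s t := by
    rcases Int.units_eq_one_or s.toMul with hs | hs <;>
      rcases Int.units_eq_one_or t.toMul with ht | ht <;>
      simp only [toMul_add, hs, ht] <;> decide

end Units

/-! ### Linearization -/

section Lin

variable (k : Type) [CommRing k] (M : Type) [AddCommMonoid M]

/-- The `k`-linearization `k ⊗_ℤ A` of the Grothendieck group `A` of `M`. -/
def Lin : Type := k ⊗[ℤ] Gro M

instance : AddCommGroup (Lin k M) := inferInstanceAs (AddCommGroup (k ⊗[ℤ] Gro M))

instance : Module k (Lin k M) := inferInstanceAs (Module k (k ⊗[ℤ] Gro M))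

variable {M}

/-- The canonical map from `M` to its linearization. -/
def gen : M →+ Lin k M where
  toFun x := (1 : k) ⊗ₜ[ℤ] Gro.of x
  map_zero' := by rw [map_zero, TensorProduct.tmul_zero]; rfl
  map_add' x y := by rw [map_add, TensorProduct.tmul_add]; rfl

variable {k} {E : Type} [AddCommGroup E] [Module k E]

theorem Lin.hom_ext {f g : Lin k M →ₗ[k] E} (h : ∀ x, f (gen k x) = g (gen k x)) : f = g := by
  refine TensorProduct.AlgebraTensorModule.curry_injective ?_
  ext a
  change f ((1 : k) ⊗ₜ[ℤ] a) = g ((1 : k) ⊗ₜ[ℤ] a)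
  induction a using Gro.ind with | h x y =>
  rw [TensorProduct.tmul_sub]
  exact (map_sub f _ _).trans (((congrArg₂ (· - ·) (h x) (h y))).trans (map_sub g _ _).symm)

/-- Additive maps on `M` extend linearly. -/
def extend (f : M →+ E) : Lin k M →ₗ[k] E :=
  LinearMap.liftBaseChange k (Gro.lift f).toIntLinearMap

@[simp]
theorem extend_gen (f : M →+ E) (x : M) : extend f (gen k x) = f x := by
  change LinearMap.liftBaseChange k (Gro.lift f).toIntLinearMap ((1 : k) ⊗ₜ[ℤ] Gro.of x) = f x
  rw [LinearMap.liftBaseChange_tmul, one_smul]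
  exact Gro.lift_of f x

end Lin

/-! ### The biset category and biset functors -/

section Category

variable (k : Type) [CommRing k]

variable {K H G F : Type} [Group K] [Group H] [Group G] [Group F]

/-- The `k`-bilinear extension `kB(K, H) × kB(H, G) → kB(K, G)` of the composition of bisets. -/
def compLin : Lin k (BisetClass K H) →ₗ[k] Lin k (BisetClass H G) →ₗ[k] Lin k (BisetClass K G) :=
  extend
    { toFun := fun v => extend ((gen k).comp (compClass v))
      map_zero' := Lin.hom_ext fun u => by simp
      map_add' := fun v v' => Lin.hom_ext fun u => by simp }

variable {k} in
@[simp]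
theorem compLin_gen (v : BisetClass K H) (u : BisetClass H G) :
    compLin k (gen k v) (gen k u) = gen k (compClass v u) := by
  simp [compLin]

/-- The linear extension `kB(H, G) → kB(G, H)` of the passage to opposite bisets. -/
def opLin : Lin k (BisetClass H G) →ₗ[k] Lin k (BisetClass G H) :=
  extend ((gen k).comp opClass)

variable {k} in
@[simp]
theorem opLin_gen (u : BisetClass H G) : opLin k (gen k u) = gen k (opClass u) := by
  simp [opLin]

theorem compLin_id_left [Finite H] (a : Lin k (BisetClass H G)) :
    compLin k (gen k (idClass H)) a = a := by
  have : compLin k (gen k (idClass H)) = (LinearMap.id : Lin k (BisetClass H G) →ₗ[k] _) :=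
    Lin.hom_ext fun u => by simp [compClass_id_left]
  rw [this]
  rfl

theorem compLin_id_right [Finite G] (a : Lin k (BisetClass H G)) :
    compLin k a (gen k (idClass G)) = a := by
  have : (compLin k).flip (gen k (idClass G)) = (LinearMap.id : Lin k (BisetClass H G) →ₗ[k] _) :=
    Lin.hom_ext fun u => by simp [compClass_id_right]
  exact LinearMap.congr_fun this a

theorem compLin_assoc (c : Lin k (BisetClass F K)) (b : Lin k (BisetClass K H))
    (a : Lin k (BisetClass H G)) :
    compLin k (compLin k c b) a = compLin k c (compLin k b a) := by
  have h1 : ∀ w v, compLin k (compLin k (gen k w : Lin k (BisetClass F K)) (gen k v)) =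
      (compLin k (gen k w)).comp (compLin k (gen k v : Lin k (BisetClass K H)) :
        Lin k (BisetClass H G) →ₗ[k] _) :=
    fun w v => Lin.hom_ext fun u => by simp [compClass_assoc]
  have h2 : ∀ w, (((compLin k).comp (compLin k (gen k w : Lin k (BisetClass F K)))).flip a) =
      (compLin k (gen k w)).comp ((compLin k : Lin k (BisetClass K H) →ₗ[k] _).flip a) :=
    fun w => Lin.hom_ext fun v => LinearMap.congr_fun (h1 w v) a
  have h3 : ((compLin k : Lin k (BisetClass F H) →ₗ[k] Lin k (BisetClass H G) →ₗ[k] _).flip a).comp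
      ((compLin k : Lin k (BisetClass F K) →ₗ[k] _).flip b) =
      (compLin k : Lin k (BisetClass F K) →ₗ[k] _).flip (compLin k b a) :=
    Lin.hom_ext fun w => LinearMap.congr_fun (h2 w) b
  exact LinearMap.congr_fun h3 c

theorem opLin_comp (b : Lin k (BisetClass K H)) (a : Lin k (BisetClass H G)) :
    opLin k (compLin k b a) = compLin k (opLin k a) (opLin k b) := by
  have h1 : ∀ v, (opLin k).comp (compLin k (gen k v : Lin k (BisetClass K H))) =
      ((compLin k).flip (opLin k (gen k v))).comp
        (opLin k : Lin k (BisetClass H G) →ₗ[k] _) :=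
    fun v => Lin.hom_ext fun u => by simp [opClass_comp]
  have h2 : (opLin k).comp ((compLin k).flip a) =
      (compLin k (opLin k a)).comp (opLin k : Lin k (BisetClass K H) →ₗ[k] _) :=
    Lin.hom_ext fun v => LinearMap.congr_fun (h1 v) a
  exact LinearMap.congr_fun h2 b

theorem opLin_id [Finite G] : opLin k (gen k (idClass G)) = gen k (idClass G) := by
  simp [opClass_id]

/-- The objects of the biset category `k𝒞`: all finite groups. -/
structure BisetCat (k : Type) [CommRing k] : Type 1 where
  carrier : Type
  [group : Group carrier]
  [finite : Finite carrier]

attribute [instance] BisetCat.group BisetCat.finite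

/-- The biset category `k𝒞`: morphisms from `G` to `H` are the elements of
`kB(H, G) = k ⊗ B(H, G)`. -/
instance : Category (BisetCat k) where
  Hom G H := Lin k (BisetClass H.carrier G.carrier)
  id G := gen k (idClass G.carrier)
  comp f g := compLin k g f
  id_comp f := compLin_id_right k f
  comp_id f := compLin_id_left k f
  assoc f g h := (compLin_assoc k h g f).symm

instance : Preadditive (BisetCat k) where
  homGroup G H := inferInstanceAs (AddCommGroup (Lin k (BisetClass H.carrier G.carrier)))
  add_comp _ _ _ f f' g := (compLin k g).map_add f f'
  comp_add _ _ _ f g g' := LinearMap.congr_fun ((compLin k).map_add g g') f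

instance : Linear k (BisetCat k) where
  homModule G H := inferInstanceAs (Module k (Lin k (BisetClass H.carrier G.carrier)))
  smul_comp _ _ _ r f g := (compLin k g).map_smul r f
  comp_smul _ _ _ f r g := LinearMap.congr_fun ((compLin k).map_smul r g) f

/-- The category `ℱ_k` of biset functors over `k`: the `k`-linear functors from `k𝒞` to
`k`-modules, with natural transformations as morphisms. -/
abbrev BisetFunctor : Type 1 :=
  ObjectProperty.FullSubcategory
    (fun F : BisetCat k ⥤ ModuleCat.{0} k => F.Additive ∧ F.Linear k)

variable {k}

/-- The value `F(G)`. -/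
abbrev BisetFunctor.val (F : BisetFunctor k) (G : BisetCat k) : ModuleCat.{0} k := F.obj.obj G

/-- The map `F(α) : F(G) → F(H)`, for `α` in `kB(H, G)`. -/
abbrev BisetFunctor.act (F : BisetFunctor k) {G H : BisetCat k} (α : G ⟶ H) :
    F.val G →ₗ[k] F.val H := (F.obj.map α).hom

/-- The biset functor over `k` with given values on groups and on classes of bisets. -/
def mkFunctor (V : BisetCat k → Type) [∀ G, AddCommGroup (V G)] [∀ G, Module k (V G)]
    (ρ : ∀ G H : BisetCat k, BisetClass H.carrier G.carrier →+ (V G →ₗ[k] V H))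
    (hid : ∀ G, ρ G G (idClass G.carrier) = LinearMap.id)
    (hcomp : ∀ (G H K : BisetCat k) (v : BisetClass K.carrier H.carrier)
      (u : BisetClass H.carrier G.carrier), ρ G K (compClass v u) = (ρ H K v).comp (ρ G H u)) :
    BisetFunctor k where
  obj :=
    { obj := fun G => ModuleCat.of k (V G)
      map := fun {G H} α => ModuleCat.ofHom
        (extend (ρ G H) α)
      map_id := fun G => by
        ext1
        change extend (ρ G G) (gen k (idClass G.carrier)) = LinearMap.id
        rw [extend_gen, hid]
      map_comp := fun {G H K} α β => by
        ext1
        change extend (ρ G K) (compLin k β α) = (extend (ρ H K) β).comp (extend (ρ G H) α)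
        have h1 : ∀ v, (extend (ρ G K)).comp (compLin k (gen k v)) =
            (LinearMap.llcomp k _ _ _ (extend (ρ H K) (gen k v))).comp (extend (ρ G H)) :=
          fun v => Lin.hom_ext fun u => by simp [hcomp]; rfl
        have h2 : (extend (ρ G K)).comp ((compLin k).flip α) =
            ((LinearMap.llcomp k _ _ _).flip (extend (ρ G H) α)).comp (extend (ρ H K)) :=
          Lin.hom_ext fun v => LinearMap.congr_fun (h1 v) α
        exact LinearMap.congr_fun h2 β }
  property := ⟨⟨fun {G H α β} => ModuleCat.hom_ext (map_add (extend (ρ G H)) α β)⟩,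
    ⟨fun {G H} α r => ModuleCat.hom_ext (map_smul (extend (ρ G H)) r α)⟩⟩

theorem mkFunctor_act_gen (V : BisetCat k → Type) [∀ G, AddCommGroup (V G)] [∀ G, Module k (V G)]
    (ρ : ∀ G H : BisetCat k, BisetClass H.carrier G.carrier →+ (V G →ₗ[k] V H))
    (hid : ∀ G, ρ G G (idClass G.carrier) = LinearMap.id)
    (hcomp : ∀ (G H K : BisetCat k) (v : BisetClass K.carrier H.carrier)
      (u : BisetClass H.carrier G.carrier), ρ G K (compClass v u) = (ρ H K v).comp (ρ G H u))
    (G H : BisetCat k) (u : BisetClass H.carrier G.carrier) :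
    (mkFunctor V ρ hid hcomp).act (G := G) (H := H) (gen k u) = ρ G H u :=
  extend_gen (k := k) (ρ G H) u

/-- A morphism of biset functors from a family of linear maps compatible with all bisets. -/
def mkHom (F F' : BisetFunctor k) (η : ∀ G : BisetCat k, F.val G →ₗ[k] F'.val G)
    (h : ∀ (G H : BisetCat k) (u : BisetClass H.carrier G.carrier),
      (η H).comp (F.act (G := G) (H := H) (gen k u)) =
        (F'.act (G := G) (H := H) (gen k u)).comp (η G)) : F ⟶ F' :=
  ObjectProperty.homMk
    { app := fun G => ModuleCat.ofHom (η G)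
      naturality := fun G H α => by
        let lin : ∀ F : BisetFunctor k,
            Lin k (BisetClass H.carrier G.carrier) →ₗ[k] (F.val G →ₗ[k] F.val H) := fun F =>
          { toFun := fun α => F.act (G := G) (H := H) α
            map_add' := fun α β => congrArg ModuleCat.Hom.hom
              (F.property.1.map_add (X := G) (Y := H) (f := α) (g := β))
            map_smul' := fun r α => congrArg ModuleCat.Hom.hom
              (F.property.2.map_smul (X := G) (Y := H) α r) }
        have h1 : (LinearMap.llcomp k _ _ _ (η H)).comp (lin F) =
            ((LinearMap.llcomp k _ _ _).flip (η G)).comp (lin F') :=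
          Lin.hom_ext fun u => h G H u
        exact ModuleCat.hom_ext (LinearMap.congr_fun h1 α) }

/-- The action `[X] ↦ [U ×_G X]` of (the class of) an `(H, G)`-biset `U`, from `kB(G)` to
`kB(H)`. -/
def burnsideAct (k : Type) [CommRing k] :
    BisetClass H G →+ (Lin k (GSetClass G) →ₗ[k] Lin k (GSetClass H)) where
  toFun u := extend ((gen k).comp (actClass u))
  map_zero' := Lin.hom_ext fun x => by simp
  map_add' u u' := Lin.hom_ext fun x => by simp

theorem burnsideAct_gen (u : BisetClass H G) (x : GSetClass G) :
    burnsideAct k u (gen k x) = gen k (actClass u x) := by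
  simp [burnsideAct]

/-- The linearized Burnside functor `kB`: `kB(G) = k ⊗ B(G)`, and `[U][X] = [U ×_G X]` for an
`(H, G)`-biset `U` and a `G`-set `X`. -/
def burnsideFunctor (k : Type) [CommRing k] : BisetFunctor k :=
  mkFunctor (fun G => Lin k (GSetClass G.carrier)) (fun _ _ => burnsideAct k)
    (fun G => Lin.hom_ext fun x => by simp [burnsideAct_gen, actClass_id])
    (fun G H K v u => Lin.hom_ext fun x => by simp [burnsideAct_gen, actClass_comp])

/-- The action of (the class of) an `(H, G)`-biset on units by tensor induction. -/
def unitAct [Finite H] [Finite G] :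
    BisetClass H G →+ (UnitGroup G →ₗ[ZMod 2] UnitGroup H) where
  toFun u := (MonoidHom.toAdditive (Units.map (tensorInd u))).toZModLinearMap 2
  map_zero' := by
    refine LinearMap.ext fun x => Additive.toMul.injective (Units.ext ?_)
    exact tensorInd_zero _
  map_add' u u' := by
    refine LinearMap.ext fun x => Additive.toMul.injective (Units.ext ?_)
    exact tensorInd_add u u' _

/-- The biset functor `Bˣ` over `𝔽₂`: `Bˣ(G)` is the group of units of the Burnside ring `B(G)`,
and bisets act by tensor induction. -/
def unitFunctor : BisetFunctor (ZMod 2) :=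
  mkFunctor (fun G => UnitGroup G.carrier) (fun _ _ => unitAct)
    (fun G => by
      refine LinearMap.ext fun x => Additive.toMul.injective (Units.ext ?_)
      exact tensorInd_id _)
    (fun G H K v u => by
      refine LinearMap.ext fun x => Additive.toMul.injective (Units.ext ?_)
      exact tensorInd_comp v u _)

/-- The `M`-dual `Hom_k(F, M)` of a biset functor `F`: an element `α` of `kB(H, G)` acts by the
transpose of `F(αᵒᵖ)`. -/
def dualFunctor (F : BisetFunctor k) (M : Type) [AddCommGroup M] [Module k M] :
    BisetFunctor k where
  obj :=
    { obj := fun G => ModuleCat.of k (F.val G →ₗ[k] M)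
      map := fun {G H} α => ModuleCat.ofHom
        (LinearMap.lcomp k M (F.act (G := H) (H := G) (opLin k α)))
      map_id := fun G => by
        ext1
        have : F.obj.map (X := G) (Y := G) (opLin k (gen k (idClass G.carrier))) = 𝟙 _ := by
          rw [opLin_id]
          exact F.obj.map_id G
        change LinearMap.lcomp k M
          (F.obj.map (X := G) (Y := G) (opLin k (gen k (idClass G.carrier)))).hom = LinearMap.id
        rw [this]
        rfl
      map_comp := fun {G H K} α β => by
        ext1
        have : F.obj.map (X := K) (Y := G) (opLin k (compLin k β α)) =
            F.obj.map (X := K) (Y := H) (opLin k β) ≫ F.obj.map (X := H) (Y := G) (opLin k α) := by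
          rw [opLin_comp]
          exact F.obj.map_comp (X := K) (Y := H) (Z := G) (opLin k β) (opLin k α)
        change LinearMap.lcomp k M (F.obj.map (X := K) (Y := G) (opLin k (compLin k β α))).hom = _
        rw [this]
        rfl }
  property := by
    obtain ⟨hadd, hlin⟩ := F.property
    refine ⟨⟨fun {G H α β} => ModuleCat.hom_ext ?_⟩, ⟨fun {G H} α r => ModuleCat.hom_ext ?_⟩⟩
    · have : F.obj.map (X := H) (Y := G) (opLin k (α + β)) =
          F.obj.map (X := H) (Y := G) (opLin k α) + F.obj.map (X := H) (Y := G) (opLin k β) := by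
        rw [← hadd.map_add]
        exact congrArg (F.obj.map (X := H) (Y := G)) (map_add (opLin k) α β)
      change LinearMap.lcomp k M (F.obj.map (X := H) (Y := G) (opLin k (α + β))).hom = _
      rw [this]
      refine LinearMap.ext fun φ => LinearMap.ext fun x => ?_
      exact map_add φ _ _
    · have : F.obj.map (X := H) (Y := G) (opLin k (r • α)) =
          r • F.obj.map (X := H) (Y := G) (opLin k α) := by
        rw [← hlin.map_smul]
        exact congrArg (F.obj.map (X := H) (Y := G)) (map_smul (opLin k) r α)
      change LinearMap.lcomp k M (F.obj.map (X := H) (Y := G) (opLin k (r • α))).hom = _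
      rw [this]
      refine LinearMap.ext fun φ => LinearMap.ext fun x => ?_
      exact map_smul φ r _

theorem dualFunctor_act_gen (F : BisetFunctor k) (M : Type) [AddCommGroup M] [Module k M]
    (G H : BisetCat k) (u : BisetClass H.carrier G.carrier) (φ : F.val G →ₗ[k] M) :
    (dualFunctor F M).act (G := G) (H := H) (gen k u) φ =
      φ.comp (F.act (G := H) (H := G) (gen k (opClass u))) := by
  rw [← opLin_gen]
  rfl

end Category


/-! ### The morphism from the Burnside functor to the dual of the functor of units -/

section Jmath

variable {G : Type} [Group G] [Finite G]

/-- The linear form on `Bˣ(G)` attached to (the class of) a finite `G`-set `Y`: the additive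
extension of `G/K ↦ (u ↦ |u ^ K|₊)`. -/
def jClass : GSetClass G →+ (UnitGroup G →ₗ[ZMod 2] ZMod 2) where
  toFun y :=
    (signPlus.comp (MonoidHom.toAdditive (Units.map (orbitProdClass y)))).toZModLinearMap 2
  map_zero' := LinearMap.ext fun u => by
    change signPlus (Additive.ofMul (Units.map (orbitProdClass 0) u.toMul)) = 0
    rw [orbitProdClass_zero, ← map_zero signPlus]
    exact congrArg signPlus (Additive.toMul.injective (Units.ext rfl))
  map_add' y y' := LinearMap.ext fun u => by
    change signPlus (Additive.ofMul (Units.map (orbitProdClass (y + y')) u.toMul)) =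
      signPlus (Additive.ofMul (Units.map (orbitProdClass y) u.toMul)) +
      signPlus (Additive.ofMul (Units.map (orbitProdClass y') u.toMul))
    rw [orbitProdClass_add, ← map_add signPlus]
    exact congrArg signPlus (Additive.toMul.injective (Units.ext rfl))

theorem jClass_apply (y : GSetClass G) (u : UnitGroup G) :
    jClass y u = signPlus (Additive.ofMul (Units.map (orbitProdClass y) u.toMul)) := rfl

/-- On the transitive `G`-set `G/K`, the linear form is `u ↦ |u ^ K|₊`. -/
theorem jClass_quotient (K : Subgroup G) (u : UnitGroup G) :
    jClass (GSetClass.mk G (G ⧸ K)) u =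
      signPlus (Additive.ofMul (Units.map (mark K : Burnside G →* ℤ) u.toMul)) := by
  rw [jClass_apply]
  refine congrArg signPlus (Additive.toMul.injective (Units.ext ?_))
  change orbitProdClass (GSetClass.mk G (G ⧸ K)) (u.toMul : Burnside G) = mark K u.toMul
  rw [orbitProdClass_mk, orbitProd_quotient]

theorem jClass_act {H : Type} [Group H] [Finite H] (a : BisetClass H G) (x : GSetClass G)
    (u : UnitGroup H) :
    jClass (actClass a x) u =
      jClass x (Additive.ofMul (Units.map (tensorInd (opClass a)) u.toMul)) := by
  rw [jClass_apply, jClass_apply]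
  refine congrArg signPlus (Additive.toMul.injective (Units.ext ?_))
  change orbitProdClass (actClass a x) (u.toMul : Burnside H) =
    orbitProdClass x (tensorInd (opClass a) u.toMul)
  rw [tensorInd_spec, opClass_opClass]

/-- The linear map `𝔽₂B(G) → Hom(Bˣ(G), 𝔽₂)` with `G/K ↦ (u ↦ |u ^ K|₊)`. -/
def jLin (G : Type) [Group G] [Finite G] :
    Lin (ZMod 2) (GSetClass G) →ₗ[ZMod 2] (UnitGroup G →ₗ[ZMod 2] ZMod 2) := extend jClass

theorem jLin_gen (x : GSetClass G) : jLin G (gen (ZMod 2) x) = jClass x :=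
  extend_gen jClass x

end Jmath

/-- The dual functor of `Bˣ`, with values `Hom_{𝔽₂}(Bˣ(G), 𝔽₂)`. -/
def dualUnitFunctor : BisetFunctor (ZMod 2) := dualFunctor unitFunctor (ZMod 2)

/-- The morphism of biset functors `𝔽₂B → Hom(Bˣ, 𝔽₂)`, with `G/K ↦ (u ↦ |u ^ K|₊)`. -/
def jmath : burnsideFunctor (ZMod 2) ⟶ dualUnitFunctor :=
  mkHom (burnsideFunctor (ZMod 2)) dualUnitFunctor
    (fun G => jLin G.carrier)
    (fun G H a => by
      refine Lin.hom_ext fun x => ?_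
      have h1 : (burnsideFunctor (ZMod 2)).act (G := G) (H := H) (gen (ZMod 2) a) =
        burnsideAct (ZMod 2) a := mkFunctor_act_gen _ _ _ _ G H a
      have h2 : unitFunctor.act (G := H) (H := G) (gen (ZMod 2) (opClass a)) =
        unitAct (opClass a) := mkFunctor_act_gen _ _ _ _ H G (opClass a)
      have h3 := dualFunctor_act_gen unitFunctor (ZMod 2) G H a (jClass x)
      rw [h2] at h3
      rw [h1]
      change jLin H.carrier (burnsideAct (ZMod 2) a (gen (ZMod 2) x)) =
        dualUnitFunctor.act (G := G) (H := H) (gen (ZMod 2) a) (jLin G.carrier (gen (ZMod 2) x))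
      rw [burnsideAct_gen, jLin_gen, jLin_gen]
      exact (LinearMap.ext fun u => jClass_act a x u).trans h3.symm)

/-! ### Subfunctors, generation and finiteness conditions -/

section Subfunctor

variable {k : Type} [CommRing k]

/-- A subfunctor of a biset functor. -/
structure Subfunctor (F : BisetFunctor k) where
  obj : ∀ G : BisetCat k, Submodule k (F.val G)
  map_mem : ∀ {G H : BisetCat k} (α : G ⟶ H) {v : F.val G}, v ∈ obj G → F.act α v ∈ obj H

/-- A subfunctor, as a biset functor. -/
def Subfunctor.toFunctor {F : BisetFunctor k} (S : Subfunctor F) : BisetFunctor k where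
  obj :=
    { obj := fun G => ModuleCat.of k (S.obj G)
      map := fun α => ModuleCat.ofHom ((F.act α).restrict fun _ hv => S.map_mem α hv)
      map_id := fun G => ModuleCat.hom_ext (LinearMap.ext fun v => Subtype.ext
        (LinearMap.congr_fun (congrArg ModuleCat.Hom.hom (F.obj.map_id G)) v.1))
      map_comp := fun α β => ModuleCat.hom_ext (LinearMap.ext fun v => Subtype.ext
        (LinearMap.congr_fun (congrArg ModuleCat.Hom.hom (F.obj.map_comp α β)) v.1)) }
  property :=
    ⟨⟨fun {_ _ _ _} => ModuleCat.hom_ext (LinearMap.ext fun v => Subtype.ext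
        (LinearMap.congr_fun (congrArg ModuleCat.Hom.hom F.property.1.map_add) v.1))⟩,
      ⟨fun α r => ModuleCat.hom_ext (LinearMap.ext fun v => Subtype.ext
        (LinearMap.congr_fun (congrArg ModuleCat.Hom.hom (F.property.2.map_smul α r)) v.1))⟩⟩

/-- The component at `G` of a morphism of biset functors. -/
def component {F F' : BisetFunctor k} (η : F ⟶ F') (G : BisetCat k) : F.val G →ₗ[k] F'.val G :=
  (η.hom.app G).hom

theorem component_act {F F' : BisetFunctor k} (η : F ⟶ F') {G H : BisetCat k} (α : G ⟶ H)
    (v : F.val G) : component η H (F.act α v) = F'.act α (component η G v) :=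
  LinearMap.congr_fun (congrArg ModuleCat.Hom.hom (η.hom.naturality α)) v

/-- The kernel of a morphism of biset functors. -/
def kernelSubfunctor {F F' : BisetFunctor k} (η : F ⟶ F') : Subfunctor F where
  obj G := LinearMap.ker (component η G)
  map_mem α v hv := by
    rw [LinearMap.mem_ker] at hv ⊢
    rw [component_act, hv, map_zero]

/-- The elements of a biset functor `F`: the pairs `(R, v)` with `R` a finite group and `v` in
`F(R)`. -/
abbrev Elements (F : BisetFunctor k) : Type 1 := Σ R : BisetCat k, F.val R

/-- The subfunctor generated by a set `𝒢` of elements: the intersection of all subfunctors that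
contain `𝒢`. -/
def generated (F : BisetFunctor k) (𝒢 : Set (Elements F)) : Subfunctor F where
  obj G := ⨅ S : {S : Subfunctor F // ∀ p ∈ 𝒢, p.2 ∈ S.obj p.1}, S.1.obj G
  map_mem α v hv := by
    rw [Submodule.mem_iInf] at hv ⊢
    exact fun S => S.1.map_mem α (hv S)

/-- `𝒢` generates `F`, i.e. `⟨𝒢⟩ = F`. -/
def Generates (F : BisetFunctor k) (𝒢 : Set (Elements F)) : Prop :=
  ∀ G : BisetCat k, (generated F 𝒢).obj G = ⊤

/-- Finitely generated biset functors. -/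
def FinitelyGenerated (F : BisetFunctor k) : Prop :=
  ∃ 𝒢 : Set (Elements F), 𝒢.Finite ∧ Generates F 𝒢

/-- Finitely presented biset functors: those `F` for which there is an exact sequence
`Q → P → F → 0` where `P` and `Q` are finitely generated and projective. -/
def FinitelyPresented (F : BisetFunctor k) : Prop :=
  ∃ (Q P : BisetFunctor k) (f : Q ⟶ P) (g : P ⟶ F),
    FinitelyGenerated Q ∧ Projective Q ∧ FinitelyGenerated P ∧ Projective P ∧
    (∀ G : BisetCat k, Function.Exact (component f G) (component g G)) ∧
    ∀ G : BisetCat k, Function.Surjective (component g G)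

/-- The trivial group, as an object of the biset category. -/
def trivialGroup (k : Type) [CommRing k] : BisetCat k := ⟨Unit⟩

end Subfunctor

/-- The kernel `L` of `𝔽₂B → Hom(Bˣ, 𝔽₂)`, as a biset functor over `𝔽₂`. -/
def kernelFunctor : BisetFunctor (ZMod 2) := (kernelSubfunctor jmath).toFunctor

end BurnsideUnits

end

/-! Everything is read off from the morphism `jmath` and from the fact that `𝔽₂B` is generated by
the class `point` of a point over the trivial group. A finite `G`-set, viewed as a `(G, 1)`-biset,
sends the point to itself, so every element of `𝔽₂B(G)` is even the image of `point` under a single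
morphism `1 → G` (`exists_act_point`).

Generation of the dual. A unit is determined by its marks, all of which are signs, so the forms in
the image of `jmath` at `G` have no common zero in `Bˣ(G)` except the identity. As `Bˣ(G)` is
finite, linear duality makes `jmath` surjective (`jLin_surjective`). Hence the dual is generated by
the image of `point`, which is the only non-zero element of its value at `1`: the unit `-1` shows
that it does not vanish.

The kernel `L` is not finitely generated. The value `L(1)` is zero. If `G` and `R` have coprime
orders, every subgroup of `G × Rᵐᵒᵖ` is a product of subgroups, so every transitive `(G, R)`-biset
factors through the trivial group (`exists_factor_of_coprime`), and morphisms `R → G` kill `L(R)`.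
Given finitely many generators, take an odd prime `p` larger than the orders of all groups where
they live; then they generate nothing at the cyclic group of order `p`. But `L` is non-zero there:
for a `p`-group the marks at the trivial subgroup and at the whole group are congruent modulo `p`,
and two signs congruent modulo an odd prime are equal, so `[G/1] - [G/G]` lies in the kernel
(`exists_mem_kernel_ne_zero`).

The dual is not finitely presented. By an argument in the manner of Schanuel's lemma, comparing a
presentation `Q → P → F → 0` of the dual with the surjection `jmath`, whose source has one
generator, would make `L` finitely generated
(`kernelFunctor_finitelyGenerated_of_finitelyPresented`). -/

noncomputable section

namespace BurnsideUnits

/-! ### Linearizations and the action on biset functors -/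

section Linearization

variable {k : Type} [CommRing k] {M : Type} [AddCommMonoid M]

/-- The quotient map by `p` vanishes on all generators, so it is zero by `Lin.hom_ext`. Applied to
ranges, spans and kernels, this reduces linear statements to classes of actual sets and bisets. -/
theorem Lin.mem_of_gen_mem (p : Submodule k (Lin k M)) (h : ∀ x, gen k x ∈ p) (a : Lin k M) :
    a ∈ p := by
  have : p.mkQ = 0 := Lin.hom_ext fun x => by
    rw [LinearMap.zero_apply, Submodule.mkQ_apply, Submodule.Quotient.mk_eq_zero]
    exact h x
  rw [← Submodule.Quotient.mk_eq_zero, ← Submodule.mkQ_apply, this, LinearMap.zero_apply]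

/-- The action of `kB(H, G)` on a biset functor, as a linear map. -/
def actLin (F : BisetFunctor k) (G H : BisetCat k) :
    Lin k (BisetClass H.carrier G.carrier) →ₗ[k] (F.val G →ₗ[k] F.val H) where
  toFun α := F.act (G := G) (H := H) α
  map_add' α β := congrArg ModuleCat.Hom.hom
    (F.property.1.map_add (X := G) (Y := H) (f := α) (g := β))
  map_smul' r α := congrArg ModuleCat.Hom.hom
    (F.property.2.map_smul (X := G) (Y := H) α r)

theorem actLin_apply (F : BisetFunctor k) (G H : BisetCat k)
    (α : Lin k (BisetClass H.carrier G.carrier)) (v : F.val G) :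
    actLin F G H α v = F.act (G := G) (H := H) α v := rfl

theorem act_id (F : BisetFunctor k) (G : BisetCat k) (v : F.val G) : F.act (𝟙 G) v = v :=
  LinearMap.congr_fun (congrArg ModuleCat.Hom.hom (F.obj.map_id G)) v

theorem act_comp (F : BisetFunctor k) {G H K : BisetCat k} (α : G ⟶ H) (β : H ⟶ K)
    (v : F.val G) : F.act (α ≫ β) v = F.act β (F.act α v) :=
  LinearMap.congr_fun (congrArg ModuleCat.Hom.hom (F.obj.map_comp α β)) v

theorem burnsideFunctor_act_gen {G H : BisetCat k} (u : BisetClass H.carrier G.carrier)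
    (x : GSetClass G.carrier) :
    (burnsideFunctor k).act (G := G) (H := H) (gen k u) (gen k x) = gen k (actClass u x) := by
  have h : (burnsideFunctor k).act (G := G) (H := H) (gen k u) = burnsideAct k u :=
    mkFunctor_act_gen _ _ _ _ G H u
  rw [h]
  exact burnsideAct_gen u x

end Linearization

/-! ### Generation of subfunctors -/

section Generation

variable {k : Type} [CommRing k]

/-- This serves as the induction principle for generated subfunctors: a property that defines a
subfunctor need only be checked on the generators. -/
theorem generated_obj_le {F : BisetFunctor k} {𝒢 : Set (Elements F)} (S : Subfunctor F)
    (hS : ∀ p ∈ 𝒢, p.2 ∈ S.obj p.1) (G : BisetCat k) : (generated F 𝒢).obj G ≤ S.obj G :=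
  iInf_le (fun S : {S : Subfunctor F // ∀ p ∈ 𝒢, p.2 ∈ S.obj p.1} => S.1.obj G) ⟨S, hS⟩

theorem mem_generated {F : BisetFunctor k} {𝒢 : Set (Elements F)} {p : Elements F} (hp : p ∈ 𝒢) :
    p.2 ∈ (generated F 𝒢).obj p.1 := by
  change p.2 ∈ ⨅ S : {S : Subfunctor F // ∀ p ∈ 𝒢, p.2 ∈ S.obj p.1}, S.1.obj p.1
  rw [Submodule.mem_iInf]
  exact fun S => S.2 p hp

/-- The inverse image of a subfunctor under a morphism. -/
def Subfunctor.comap {F F' : BisetFunctor k} (η : F ⟶ F') (S : Subfunctor F') : Subfunctor F where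
  obj G := (S.obj G).comap (component η G)
  map_mem α v hv := by
    rw [Submodule.mem_comap] at hv ⊢
    rw [component_act]
    exact S.map_mem α hv

theorem component_comp {F F' F'' : BisetFunctor k} (η : F ⟶ F') (θ : F' ⟶ F'') (G : BisetCat k)
    (v : F.val G) : component (η ≫ θ) G v = component θ G (component η G v) := rfl

/-- Links the pointwise surjectivity of `jmath` with the categorical notion of projective object,
whose lifting property refers to epimorphisms. -/
theorem epi_of_surjective {F F' : BisetFunctor k} (η : F ⟶ F')
    (h : ∀ G, Function.Surjective (component η G)) : Epi η where
  left_cancellation {Z} θ θ' hθ := by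
    refine ObjectProperty.hom_ext _ (NatTrans.ext (funext fun G => ModuleCat.hom_ext
      (LinearMap.ext fun w => ?_)))
    obtain ⟨v, rfl⟩ := h G w
    have := congrArg (fun μ => component μ G v) hθ
    exact this

end Generation

/-! ### The Burnside functor is generated by the point -/

section Point

variable {k : Type} [CommRing k]

variable (k) in
/-- The class of a point in `kB(1)`. -/
def point : (burnsideFunctor k).val (trivialGroup k) := gen k (1 : GSetClass Unit)

/-- A `G`-set `X` is a `(G, 1)`-biset with trivial right action, and `X ×_1 pt ≅ X`. -/
theorem exists_act_one {G : Type} [Group G] (x : GSetClass G) :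
    ∃ u : BisetClass G Unit, actClass u 1 = x := by
  induction x using GSetClass.ind with | h X =>
  let _ : MulAction (G × Unitᵐᵒᵖ) X := MulAction.compHom X (MonoidHom.fst G Unitᵐᵒᵖ)
  refine ⟨GSetClass.mk _ X, ?_⟩
  rw [GSetClass.one_def, actClass_mk]
  refine GSetClass.mk_eq_mk ⟨Tens.lift (fun x _ => x) ?_, fun x => Tens.mk G Unit x (), ?_, ?_⟩ ?_
  · intro g u x
    -- The pair `(1, op g)` acts through its first coordinate, hence trivially.
    exact one_smul G u
  · intro x
    induction x using Tens.ind with | h v u => rfl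
  · intro x
    rfl
  · intro g x
    induction x using Tens.ind with | h v u => rfl

/-- Evaluation at `point` is linear in the morphism, so its range is a submodule, and it contains
the class of every `G`-set. That one morphism suffices, rather than a sum, lets later arguments
transport a single `α` between functors. -/
theorem exists_act_point (G : BisetCat k) (x : (burnsideFunctor k).val G) :
    ∃ α : trivialGroup k ⟶ G, (burnsideFunctor k).act α (point k) = x := by
  refine Lin.mem_of_gen_mem
    (LinearMap.range ((actLin (burnsideFunctor k) (trivialGroup k) G).flip (point k))) ?_ x
  intro x
  obtain ⟨u, rfl⟩ := exists_act_one x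
  exact ⟨gen k u, burnsideFunctor_act_gen (G := trivialGroup k) (H := G) u 1⟩

theorem mk_quotient_of_subsingleton {G : Type} [Group G] [Finite G] [Subsingleton G]
    (K : Subgroup G) : GSetClass.mk G (G ⧸ K) = 1 := by
  have : Subsingleton (G ⧸ K) := Quot.Subsingleton
  have : Unique (G ⧸ K) := uniqueOfSubsingleton ((1 : G) : G ⧸ K)
  rw [GSetClass.one_def]
  exact GSetClass.mk_eq_mk (Equiv.ofUnique _ _) fun _ _ => rfl

theorem exists_smul_point (x : (burnsideFunctor k).val (trivialGroup k)) :
    ∃ c : k, c • point k = x := by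
  -- Every finite set over the trivial group is a disjoint union of points, so its class is a
  -- multiple of the class of a point.
  refine Submodule.mem_span_singleton.1
    (Lin.mem_of_gen_mem (Submodule.span k {(gen k (1 : GSetClass Unit))}) ?_ x)
  intro y
  induction y using gset_ind with
  | h0 => rw [map_zero]; exact zero_mem _
  | hK K =>
    rw [mk_quotient_of_subsingleton]
    exact Submodule.mem_span_singleton_self _
  | hadd a b ha hb => rw [map_add]; exact add_mem ha hb

end Point

/-! ### Surjectivity of the morphism to the dual of the functor of units -/

section Surjectivity

variable {G : Type} [Group G] [Finite G]

theorem signPlus_eq_zero {s : Additive ℤˣ} : signPlus s = 0 ↔ s = 0 := by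
  change (if s.toMul = 1 then (0 : ZMod 2) else 1) = 0 ↔ _
  by_cases h : s.toMul = 1
  · simp only [h, if_true, true_iff]
    exact h
  · simp only [h, if_false, one_ne_zero, false_iff]
    exact h

theorem unit_ext {u v : UnitGroup G}
    (h : ∀ K : Subgroup G, mark K (u.toMul : Burnside G) = mark K (v.toMul : Burnside G)) :
    u = v :=
  Additive.toMul.injective (Units.ext (burnside_ext h))

/-- A unit is determined by its marks, each equal to `1` or `-1`, at the finitely many subgroups.
Finiteness makes `Bˣ(G)` finite-dimensional over `𝔽₂`, as the duality argument for surjectivity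
requires. -/
instance : Finite (UnitGroup G) := by
  refine Finite.of_injective (β := Subgroup G → ℤˣ)
    (fun u K => Units.map (mark K : Burnside G →* ℤ) u.toMul) fun u v h => unit_ext fun K => ?_
  exact congrArg Units.val (congrFun h K)

/-- Testing on the sets `G/K` shows that every mark of `u` is `1`; Burnside's theorem then gives `u
= 1`, which is `0` in additive notation. -/
theorem unit_eq_zero_of_jClass {u : UnitGroup G} (h : ∀ x : GSetClass G, jClass x u = 0) :
    u = 0 := by
  refine unit_ext fun K => ?_
  have h1 := h (GSetClass.mk G (G ⧸ K))
  rw [jClass_quotient, signPlus_eq_zero] at h1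
  have h2 : mark K (u.toMul : Burnside G) = 1 :=
    congrArg (fun s : Additive ℤˣ => (s.toMul : ℤ)) h1
  rw [h2]
  exact (map_one (mark K)).symm

/-- In the dual of a finite-dimensional space, a subspace is the annihilator of its coannihilator.
The coannihilator of the image consists of units with all marks equal to `1`, so it is trivial and
the image is the whole dual. -/
theorem jLin_surjective (G : Type) [Group G] [Finite G] : Function.Surjective (jLin G) := by
  rw [← LinearMap.range_eq_top]
  have h : (LinearMap.range (jLin G) :
      Submodule (ZMod 2) (Module.Dual (ZMod 2) (UnitGroup G))).dualCoannihilator = ⊥ := by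
    refine (Submodule.eq_bot_iff _).2 fun u hu => unit_eq_zero_of_jClass fun x => ?_
    rw [Submodule.mem_dualCoannihilator] at hu
    rw [← jLin_gen]
    exact hu _ ⟨gen (ZMod 2) x, rfl⟩
  rw [← Subspace.dualCoannihilator_dualAnnihilator_eq (K := ZMod 2) (V := UnitGroup G)
    (W := LinearMap.range (jLin G)), h]
  exact Submodule.dualAnnihilator_bot

theorem jmath_surjective (G : BisetCat (ZMod 2)) : Function.Surjective (component jmath G) :=
  jLin_surjective G.carrier

theorem jmath_point_ne_zero : component jmath (trivialGroup (ZMod 2)) (point (ZMod 2)) ≠ 0 := by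
  intro h
  -- The form is tested on the unit `-1`, whose mark at the trivial subgroup is `-1` and not `1`.
  have h1 : jClass (1 : GSetClass Unit) (Additive.ofMul (-1)) = 0 := by
    rw [← jLin_gen]
    exact LinearMap.congr_fun h _
  -- Writing the point as a quotient of the trivial group turns the form into the sign of a mark.
  rw [← mk_quotient_of_subsingleton (⊥ : Subgroup Unit), jClass_quotient, signPlus_eq_zero] at h1
  have h3 : mark (⊥ : Subgroup Unit) (-1 : Burnside Unit) = 1 :=
    congrArg (fun s : Additive ℤˣ => (s.toMul : ℤ)) h1
  rw [map_neg, map_one] at h3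
  norm_num at h3

theorem eq_jmath_point {u : dualUnitFunctor.val (trivialGroup (ZMod 2))} (hu : u ≠ 0) :
    u = component jmath (trivialGroup (ZMod 2)) (point (ZMod 2)) := by
  obtain ⟨x, rfl⟩ := jmath_surjective _ u
  obtain ⟨c, rfl⟩ := exists_smul_point x
  have hc : c = 1 := by
    -- `ZMod 2` unfolds to `Fin 2`, so `c` is `0` or `1`, and `0` is excluded because `u` is
    -- non-zero.
    refine (Fin.exists_fin_two.1 ⟨c, rfl⟩).resolve_left fun h => hu ?_
    have : c = 0 := h
    rw [this, zero_smul, map_zero]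
  rw [hc, one_smul]

theorem dualUnitFunctor_trivialGroup :
    Nonempty (dualUnitFunctor.val (trivialGroup (ZMod 2)) ≃ₗ[ZMod 2] ZMod 2) := by
  refine ⟨(LinearEquiv.ofBijective (LinearMap.toSpanSingleton (ZMod 2) _
    (component jmath (trivialGroup (ZMod 2)) (point (ZMod 2)))) ⟨?_, ?_⟩).symm⟩
  · rw [← LinearMap.ker_eq_bot]
    exact LinearMap.ker_toSpanSingleton _ jmath_point_ne_zero
  · intro u
    obtain ⟨x, rfl⟩ := jmath_surjective _ u
    obtain ⟨c, rfl⟩ := exists_smul_point x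
    exact ⟨c, (map_smul _ _ _).symm⟩

/-- A form on `Bˣ(G)` lifts along `jmath` to some `α` applied to `point`, hence equals `α` applied
to the image of `point`, and that image is `u`. -/
theorem dualUnitFunctor_generates (u : dualUnitFunctor.val (trivialGroup (ZMod 2)))
    (hu : u ≠ 0) : Generates dualUnitFunctor {⟨trivialGroup (ZMod 2), u⟩} := by
  intro G
  rw [eq_top_iff]
  intro φ _
  obtain ⟨x, rfl⟩ := jmath_surjective G φ
  obtain ⟨α, rfl⟩ := exists_act_point G x
  rw [component_act, ← eq_jmath_point hu]
  exact (generated dualUnitFunctor _).map_mem α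
    (mem_generated (p := ⟨trivialGroup (ZMod 2), u⟩) rfl)

end Surjectivity

/-! ### Bisets for groups of coprime orders -/

section Coprime

variable {G R : Type} [Group G] [Group R]

/-- Raising `(g, r)` to the power `|R|` kills the second coordinate. Since `|R|` is prime to the
order of `g`, a further power restores `g`. -/
theorem mem_of_mem_of_coprime (h : (Nat.card G).Coprime (Nat.card R)) (M : Subgroup (G × R))
    {g : G} {r : R} (hgr : (g, r) ∈ M) : (g, 1) ∈ M := by
  obtain ⟨n, hn⟩ := exists_pow_eq_self_of_coprime
    (h.symm.coprime_dvd_right (orderOf_dvd_natCard g))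
  have h1 := M.pow_mem (M.pow_mem hgr (Nat.card R)) n
  simpa [hn] using h1

instance [Finite R] : Finite Rᵐᵒᵖ := Finite.of_equiv R opEquiv

/-- The orbit relation of the trivial group is equality, so `V ×_1 U` is the plain product; the pair
of coordinates descends to the quotient. -/
theorem Comp.mk_eq_mk_iff_of_unit {V U : Type} [MulAction (G × Unitᵐᵒᵖ) V] [MulAction (Unit × Rᵐᵒᵖ) U] {v v' : V} {u u' : U} :
    Comp.mk G Unit R v u = Comp.mk G Unit R v' u' ↔ v = v' ∧ u = u' := by
  refine ⟨fun h => ?_, fun h => by rw [h.1, h.2]⟩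
  have := congrArg (Comp.lift (fun v u => (v, u)) fun h v u =>
    Prod.ext (one_smul (G × Unitᵐᵒᵖ) v) (one_smul (Unit × Rᵐᵒᵖ) u).symm) h
  exact Prod.ext_iff.1 this

/-- By coprimality `M` is a product `A × B`, so that `(G × Rᵐᵒᵖ)/M ≅ G/A × Rᵐᵒᵖ/B`, and this product
is a composition over the trivial group. -/
theorem exists_factor_of_coprime [Finite G] [Finite R] (h : (Nat.card G).Coprime (Nat.card R))
    (M : Subgroup (G × Rᵐᵒᵖ)) :
    ∃ (a : BisetClass G Unit) (b : BisetClass Unit R),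
      GSetClass.mk (G × Rᵐᵒᵖ) ((G × Rᵐᵒᵖ) ⧸ M) = compClass a b := by
  -- `A` is the set of `g` with `(g, 1) ∈ M`, and `B` below the set of `r` with `(1, r) ∈ M`, each
  -- pulled back along a projection that forgets the trivial factor.
  let A : Subgroup (G × Unitᵐᵒᵖ) :=
    (M.comap (MonoidHom.inl G Rᵐᵒᵖ)).comap (MonoidHom.fst G Unitᵐᵒᵖ)
  let B : Subgroup (Unit × Rᵐᵒᵖ) :=
    (M.comap (MonoidHom.inr G Rᵐᵒᵖ)).comap (MonoidHom.snd Unit Rᵐᵒᵖ)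
  refine ⟨GSetClass.mk _ (_ ⧸ A), GSetClass.mk _ (_ ⧸ B), ?_⟩
  rw [compClass_mk]
  -- The isomorphism is the orbit map of this base point: its stabilizer is `M`, and its orbit is
  -- everything.
  let x : Comp G Unit R ((G × Unitᵐᵒᵖ) ⧸ A) ((Unit × Rᵐᵒᵖ) ⧸ B) :=
    Comp.mk G Unit R ((1 : G × Unitᵐᵒᵖ) : _ ⧸ A) ((1 : Unit × Rᵐᵒᵖ) : _ ⧸ B)
  have hx : ∀ (g : G) (r : Rᵐᵒᵖ), ((g, r) : G × Rᵐᵒᵖ) • x =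
      Comp.mk G Unit R (((g, 1) : G × Unitᵐᵒᵖ) : _ ⧸ A) (((1, r) : Unit × Rᵐᵒᵖ) : _ ⧸ B) := by
    intro g r
    simp only [x, Comp.smul_mk, MulAction.Quotient.smul_coe, smul_eq_mul, mul_one]
  have hM : M = MulAction.stabilizer (G × Rᵐᵒᵖ) x := by
    ext ⟨g, r⟩
    rw [MulAction.mem_stabilizer_iff, hx, Comp.mk_eq_mk_iff_of_unit, eq_comm, QuotientGroup.eq,
      eq_comm (a := (((1, r) : Unit × Rᵐᵒᵖ) : _ ⧸ B)), QuotientGroup.eq, inv_one, one_mul, inv_one,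
      one_mul]
    change (g, r) ∈ M ↔ (g, 1) ∈ M ∧ (1, r) ∈ M
    constructor
    · intro hgr
      have hg := mem_of_mem_of_coprime (by rwa [Nat.card_congr opEquiv.symm]) M hgr
      -- The second coordinate is recovered as `(1, r) = (g, 1)⁻¹ (g, r)`.
      exact ⟨hg, by simpa using M.mul_mem (M.inv_mem hg) hgr⟩
    · rintro ⟨hg, hr⟩
      simpa using M.mul_mem hg hr
  rw [hM]
  refine GSetClass.mk_eq_mk (Equiv.ofBijective (MulAction.ofQuotientStabilizer (G × Rᵐᵒᵖ) x)
    ⟨MulAction.injective_ofQuotientStabilizer _ x, fun y => ?_⟩)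
    fun g y => MulAction.ofQuotientStabilizer_smul _ x g y
  induction y using Comp.ind with | h v u =>
  induction v using QuotientGroup.induction_on with | H v =>
  induction u using QuotientGroup.induction_on with | H u =>
  exact ⟨((v.1, u.2) : G × Rᵐᵒᵖ), hx v.1 u.2⟩

end Coprime

/-! ### The kernel is not finitely generated -/

section Kernel

/-- This says `L(1) = 0`: the value of `𝔽₂B` at the trivial group is spanned by `point`, which has a
non-zero image. -/
theorem jmath_trivialGroup_injective {x : (burnsideFunctor (ZMod 2)).val (trivialGroup (ZMod 2))}
    (hx : component jmath _ x = 0) : x = 0 := by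
  obtain ⟨c, rfl⟩ := exists_smul_point x
  rw [map_smul] at hx
  rw [(smul_eq_zero.1 hx).resolve_right jmath_point_ne_zero, zero_smul]

/-- Each transitive biset from `R` to `G` factors through the trivial group, so its action on an
element of `L(R)` passes through `L(1) = 0`. -/
theorem act_eq_zero_of_coprime {R G : BisetCat (ZMod 2)}
    (h : (Nat.card G.carrier).Coprime (Nat.card R.carrier)) (α : R ⟶ G)
    {v : (burnsideFunctor (ZMod 2)).val R} (hv : component jmath R v = 0) :
    (burnsideFunctor (ZMod 2)).act α v = 0 := by
  refine Lin.mem_of_gen_mem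
    (LinearMap.ker ((actLin (burnsideFunctor (ZMod 2)) R G).flip v)) ?_ α
  intro u
  rw [LinearMap.mem_ker]
  induction u using gset_ind with
  | h0 => rw [map_zero, map_zero]
  | hadd a b ha hb => rw [map_add, map_add, ha, hb, add_zero]
  | hK M =>
    obtain ⟨a, b, hab⟩ := exists_factor_of_coprime h M
    rw [hab, LinearMap.flip_apply, ← compLin_gen, actLin_apply]
    refine (act_comp _ (H := trivialGroup (ZMod 2)) (gen (ZMod 2) b) (gen (ZMod 2) a) v).trans ?_
    rw [jmath_trivialGroup_injective (x := (burnsideFunctor (ZMod 2)).act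
      (H := trivialGroup (ZMod 2)) (gen (ZMod 2) b) v) (by rw [component_act, hv, map_zero]),
      map_zero]

/-! ### Marks of units and kernel elements for `p`-groups with `p` odd. -/

variable {G : Type} [Group G]

/-- For a set this is the classical congruence between its cardinality and its number of fixed
points under a `p`-group; it extends to differences. -/
theorem mark_bot_modEq_mark_top {p : ℕ} [Fact p.Prime] (hG : IsPGroup p G) (a : Burnside G) :
    mark ⊥ a ≡ mark ⊤ a [ZMOD p] := by
  have key : ∀ x : GSetClass G, mark ⊥ (Gro.of x) ≡ mark ⊤ (Gro.of x) [ZMOD p] := by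
    intro x
    induction x using GSetClass.ind with | h X =>
    have h1 : Nat.card (Fix (⊥ : Subgroup G) X) = Nat.card X :=
      Nat.card_congr (Equiv.subtypeUnivEquiv fun x k hk => by
        rw [Subgroup.mem_bot.1 hk, one_smul])
    have h2 : Nat.card (Fix (⊤ : Subgroup G) X) = Nat.card (MulAction.fixedPoints G X) :=
      Nat.card_congr (Equiv.subtypeEquivRight fun x =>
        ⟨fun h g => h g (Subgroup.mem_top g), fun h g _ => h g⟩)
    rw [mark_of, mark_of, fixCard_mk, fixCard_mk, h1, h2]
    exact Int.natCast_modEq_iff.2 (hG.card_modEq_card_fixedPoints X)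
  induction a using Gro.ind with | h x y =>
  rw [map_sub, map_sub]
  exact (key x).sub (key y)

/-- Both marks are signs, and distinct signs differ by `2`, which no prime `p > 2` divides. -/
theorem mark_bot_unit_eq {p : ℕ} [Fact p.Prime] (hp : p ≠ 2) (hG : IsPGroup p G)
    (u : (Burnside G)ˣ) : mark ⊥ (u : Burnside G) = mark ⊤ (u : Burnside G) := by
  have h := (mark_bot_modEq_mark_top hG (u : Burnside G)).dvd
  have h2 : 2 < p := lt_of_le_of_ne (Fact.out : p.Prime).two_le hp.symm
  rcases Int.isUnit_iff.1 (u.isUnit.map (mark ⊥)) with h0 | h0 <;>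
    rcases Int.isUnit_iff.1 (u.isUnit.map (mark ⊤)) with h1 | h1 <;>
    rw [h0, h1] at h ⊢
  · have := Int.le_of_dvd (by norm_num) ((dvd_neg).2 h)
    omega
  · have := Int.le_of_dvd (by norm_num) h
    omega

/-- The number of `G`-fixed points modulo `2`. -/
def fixMod (G : Type) [Group G] : Lin (ZMod 2) (GSetClass G) →ₗ[ZMod 2] ZMod 2 :=
  extend ((Nat.castAddMonoidHom (ZMod 2)).comp (fixCard (⊤ : Subgroup G)).toAddMonoidHom)

theorem exists_mem_kernel_ne_zero {p : ℕ} [Fact p.Prime] (hp : p ≠ 2) (hG : IsPGroup p G)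
    [Finite G] [Nontrivial G] : ∃ x : Lin (ZMod 2) (GSetClass G), jLin G x = 0 ∧ x ≠ 0 := by
  -- The witness is `[G/1] - [G/G]`. Its image under `jmath` compares the marks of a unit at `⊥` and
  -- `⊤`, which agree.
  refine ⟨gen (ZMod 2) (GSetClass.mk G (G ⧸ (⊥ : Subgroup G))) -
    gen (ZMod 2) (GSetClass.mk G (G ⧸ (⊤ : Subgroup G))), ?_, fun h => ?_⟩
  · rw [map_sub, jLin_gen, jLin_gen, sub_eq_zero]
    refine LinearMap.ext fun u => ?_
    rw [jClass_quotient, jClass_quotient]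
    exact congrArg signPlus (Additive.toMul.injective (Units.ext (mark_bot_unit_eq hp hG u.toMul)))
  -- The two classes stay distinct modulo `2`: `G` has no fixed point on `G/1`, as `G` is
  -- non-trivial, and exactly one on `G/G`.
  · have h1 := congrArg (fixMod G) h
    have hbot : Nat.card (Fix (⊤ : Subgroup G) (G ⧸ (⊥ : Subgroup G))) = 0 := by
      rw [Nat.card_eq_zero]
      refine Or.inl ⟨fun x => ?_⟩
      obtain ⟨g, hg⟩ := exists_ne (1 : G)
      obtain ⟨x, hx⟩ := x
      induction x using QuotientGroup.induction_on with | H y =>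
      have := hx g (Subgroup.mem_top g)
      rw [MulAction.Quotient.smul_coe, eq_comm, QuotientGroup.eq, Subgroup.mem_bot] at this
      rw [smul_eq_mul, inv_mul_eq_one] at this
      exact hg (mul_eq_right.1 this.symm)
    have htop : Nat.card (Fix (⊤ : Subgroup G) (G ⧸ (⊤ : Subgroup G))) = 1 := by
      rw [Nat.card_eq_one_iff_unique]
      have : Subsingleton (G ⧸ (⊤ : Subgroup G)) := QuotientGroup.subsingleton_quotient_top
      exact ⟨inferInstance, ⟨⟨((1 : G) : G ⧸ (⊤ : Subgroup G)), fun _ _ => Subsingleton.elim _ _⟩⟩⟩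
    rw [map_sub, map_zero, fixMod, extend_gen, extend_gen] at h1
    simp [fixCard_mk, hbot, htop] at h1

/-- The elements killed by all morphisms to a given object. -/
def annihilator {k : Type} [CommRing k] (F : BisetFunctor k) (T : BisetCat k) : Subfunctor F where
  obj G := ⨅ α : G ⟶ T, LinearMap.ker (F.act α)
  map_mem α v hv := by
    simp only [Submodule.mem_iInf, LinearMap.mem_ker] at hv ⊢
    intro β
    rw [← act_comp, hv]

theorem mem_annihilator {k : Type} [CommRing k] {F : BisetFunctor k} {T G : BisetCat k}
    {v : F.val G} : v ∈ (annihilator F T).obj G ↔ ∀ α : G ⟶ T, F.act α v = 0 := by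
  change v ∈ ⨅ α : G ⟶ T, LinearMap.ker (F.act α) ↔ _
  simp only [Submodule.mem_iInf, LinearMap.mem_ker]

/-- For a cyclic group `T` of large prime order, all generators are killed by every morphism to `T`.
The elements with this property form the subfunctor `annihilator`, which is therefore all of `L`;
yet the identity of `T` does not kill a non-zero element of `L(T)`. -/
theorem kernelFunctor_not_finitelyGenerated : ¬ FinitelyGenerated kernelFunctor := by
  rintro ⟨𝒢, hfin, hgen⟩
  obtain ⟨N, hN⟩ := (hfin.image fun q => Nat.card q.1.carrier).bddAbove
  -- `p > N` makes `p` prime to the orders of all groups carrying a generator, and `p > 2` makes it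
  -- odd.
  obtain ⟨p, hpN, hp⟩ := Nat.exists_infinite_primes (max N 2 + 1)
  have : Fact p.Prime := ⟨hp⟩
  have hcard : Nat.card (Multiplicative (ZMod p)) = p := Nat.card_zmod p
  have : Finite (Multiplicative (ZMod p)) :=
    Nat.finite_of_card_ne_zero (by rw [hcard]; exact hp.ne_zero)
  have : Nontrivial (Multiplicative (ZMod p)) :=
    Finite.one_lt_card_iff_nontrivial.1 (by rw [hcard]; exact hp.one_lt)
  let T : BisetCat (ZMod 2) := ⟨Multiplicative (ZMod p)⟩
  obtain ⟨x, hx, hx0⟩ := exists_mem_kernel_ne_zero (G := Multiplicative (ZMod p)) (p := p)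
    (by omega) (IsPGroup.of_card (n := 1) (by rw [hcard, pow_one]))
  have hmem : (⟨x, hx⟩ : kernelFunctor.val T) ∈ (annihilator kernelFunctor T).obj T := by
    refine generated_obj_le (𝒢 := 𝒢) (annihilator kernelFunctor T) (fun q hq => ?_) T
      (by rw [hgen T]; exact Submodule.mem_top)
    refine mem_annihilator.2 fun α => Subtype.ext (act_eq_zero_of_coprime ?_ α q.2.2)
    have h1 : Nat.card q.1.carrier ≤ N := hN ⟨q, hq, rfl⟩
    have h2 : Nat.card T.carrier = p := hcard
    rw [h2]
    refine (hp.coprime_iff_not_dvd).2 fun hdvd => ?_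
    have h3 := Nat.le_of_dvd Nat.card_pos hdvd
    omega
  have h0 := (act_id kernelFunctor T ⟨x, hx⟩).symm.trans (mem_annihilator.1 hmem (𝟙 T))
  exact hx0 (congrArg Subtype.val h0)

end Kernel

/-! ### The dual of the functor of units is not finitely presented -/

/-- Projectivity of `P` lifts `g` to `ψ : P ⟶ 𝔽₂B` with `jmath ∘ ψ = g`. In the other direction, a
preimage `w` of the image of `point` plays the role of a lift `𝔽₂B → P`. Then `L` is generated by `ψ
(f Q)` and the single correction term `point - ψ w`. -/
theorem kernelFunctor_finitelyGenerated_of_finitelyPresented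
    (h : FinitelyPresented dualUnitFunctor) : FinitelyGenerated kernelFunctor := by
  obtain ⟨Q, P, f, g, ⟨𝒢, hfin, hgen⟩, -, -, hP, hex, hsurj⟩ := h
  have := epi_of_surjective jmath jmath_surjective
  let ψ : P ⟶ burnsideFunctor (ZMod 2) := Projective.factorThru g jmath
  have hψ : ∀ (G : BisetCat (ZMod 2)) (w : P.val G),
      component jmath G (component ψ G w) = component g G w := fun G w => by
    rw [← component_comp, Projective.factorThru_comp]
  obtain ⟨w, hw⟩ := hsurj (trivialGroup (ZMod 2))
    (component jmath (trivialGroup (ZMod 2)) (point (ZMod 2)))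
  have hker : ∀ (G : BisetCat (ZMod 2)) (q : Q.val G),
      component jmath G (component ψ G (component f G q)) = 0 := fun G q => by
    rw [hψ]
    exact (hex G _).2 ⟨q, rfl⟩
  -- The composite `ψ ∘ f` lands in the kernel of `jmath`, because `jmath ∘ ψ ∘ f = g ∘ f = 0`.
  let η : Q ⟶ kernelFunctor := ObjectProperty.homMk
    { app := fun G => ModuleCat.ofHom (((component ψ G).comp (component f G)).codRestrict
        ((kernelSubfunctor jmath).obj G) (hker G))
      naturality := fun G H α => ModuleCat.hom_ext (LinearMap.ext fun q => Subtype.ext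
        ((congrArg (component ψ H) (component_act f α q)).trans
          (component_act ψ α (component f G q)))) }
  -- The correction term lies in `L(1)`, since `point` and `ψ w` have the same image under `jmath`.
  let d : kernelFunctor.val (trivialGroup (ZMod 2)) :=
    ⟨point (ZMod 2) - component ψ _ w, by
      change component jmath _ (point (ZMod 2) - component ψ _ w) = 0
      rw [map_sub, hψ, hw, sub_self]⟩
  refine ⟨insert ⟨trivialGroup (ZMod 2), d⟩ ((fun q => ⟨q.1, component η q.1 q.2⟩) '' 𝒢),
    (hfin.image _).insert _, fun G => ?_⟩
  rw [eq_top_iff]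
  rintro ⟨x, hx⟩ -
  set S := generated kernelFunctor
    (insert ⟨trivialGroup (ZMod 2), d⟩ ((fun q => ⟨q.1, component η q.1 q.2⟩) '' 𝒢))
  -- The inverse image of `S` under `η` is a subfunctor of `Q` containing the generators of `Q`, so
  -- it is all of `Q`.
  have hη : ∀ q : Q.val G, component η G q ∈ S.obj G := fun q => by
    refine generated_obj_le (𝒢 := 𝒢) (S.comap η) (fun q hq => ?_) G
      (by rw [hgen G]; exact Submodule.mem_top)
    exact mem_generated (p := ⟨q.1, component η q.1 q.2⟩)
      (Set.mem_insert_of_mem _ ⟨q, hq, rfl⟩)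
  obtain ⟨α, rfl⟩ := exists_act_point G x
  -- The image of `α w` under `g` is that of `α point` under `jmath`, which is zero; exactness then
  -- gives `α w = f q`.
  obtain ⟨q, hq⟩ := (hex G (P.act α w)).1 (by
    rw [component_act, hw, ← component_act]
    exact hx)
  -- This is `α point = ψ (α w) + α (point - ψ w)`, with `α w` replaced by `f q`.
  have hsum : (⟨(burnsideFunctor (ZMod 2)).act α (point (ZMod 2)), hx⟩ : kernelFunctor.val G) =
      component η G q + kernelFunctor.act α d := by
    refine Subtype.ext ?_
    change _ = component ψ G (component f G q) +
      (burnsideFunctor (ZMod 2)).act α (point (ZMod 2) - component ψ _ w)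
    rw [hq, component_act, map_sub, add_sub_cancel]
  rw [hsum]
  exact add_mem (hη q) (S.map_mem α
    (mem_generated (p := ⟨trivialGroup (ZMod 2), d⟩) (Set.mem_insert _ _)))

end BurnsideUnits
end

theorem proposition6p4 :
    (Nonempty (BurnsideUnits.dualUnitFunctor.val
        (BurnsideUnits.trivialGroup (ZMod 2)) ≃ₗ[ZMod 2] ZMod 2) ∧
      ∀ u : BurnsideUnits.dualUnitFunctor.val (BurnsideUnits.trivialGroup (ZMod 2)), u ≠ 0 →
        BurnsideUnits.Generates BurnsideUnits.dualUnitFunctor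
          {⟨BurnsideUnits.trivialGroup (ZMod 2), u⟩}) ∧
    ¬ BurnsideUnits.FinitelyGenerated BurnsideUnits.kernelFunctor ∧
    ¬ BurnsideUnits.FinitelyPresented BurnsideUnits.dualUnitFunctor := by
  exact ⟨⟨BurnsideUnits.dualUnitFunctor_trivialGroup, BurnsideUnits.dualUnitFunctor_generates⟩,
    BurnsideUnits.kernelFunctor_not_finitelyGenerated, fun h =>
      BurnsideUnits.kernelFunctor_not_finitelyGenerated
        (BurnsideUnits.kernelFunctor_finitelyGenerated_of_finitelyPresented h)⟩
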